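/- Let $\mathbf{M}$ be a complete and cocomplete closed symmetric monoidal category with unit $I$. A *bipointed single-colored operad* $\mathcal{P}^{(r_1,r_2)}$ is a single-colored symmetric operad $\mathcal{P}$ with values in $\mathbf{M}$ together with two arity-two operations $r_1,r_2 : I\to \mathcal{P}(2)$; a morphism $\phi:\mathcal{P}^{(r_1,r_2)}\to\mathcal{Q}^{(s_1,s_2)}$ is an operad morphism $\phi:\mathcal{P}\to\mathcal{Q}$ with $\phi\, r_i=s_i$ for $i=1,2$. An *orthogonal category* $\overline{\mathbf{C}}=(\mathbf{C},\perp)$ is a small category $\mathbf{C}$ with a symmetric relation $\perp$ on pairs of morphisms with common target such that $f_1\perp f_2$ implies $g f_1 h_1\perp g f_2 h_2$ for all composable $g,h_1,h_2$. The category $\mathbf{FT}(\overline{\mathbf{C}},\mathcal{P}^{(r_1,r_2)})$ of *field theories* is the full subcategory of the category of functors $\mathfrak{A}:\mathbf{C}\to\mathbf{Alg}_{\mathcal{P}}$ on those for which, for all $(f_1:c_1\to c)\perp(f_2:c_2\to c)$, the composites $$I\otimes\mathfrak{A}(c_1)\otimes\mathfrak{A}(c_2)\xrightarrow{\;r_i\otimes\mathfrak{A}(f_1)\otimes\mathfrak{A}(f_2)\;}\mathcal{P}(2)\otimes\mathfrak{A}(c)^{\otimes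 2}\longrightarrow\mathfrak{A}(c),\qquad i=1,2,$$ with the $\mathcal{P}$-action on $\mathfrak{A}(c)$ agree. Let $\phi:\mathcal{P}^{(r_1,r_2)}\to\mathcal{Q}^{(s_1,s_2)}$ be a morphism of bipointed single-colored operads, and let $j:\overline{\mathbf{C}}\to\overline{\mathbf{D}}$ be a full orthogonal subcategory, i.e. (the embedding of a full subcategory, or more generally) a fully faithful functor such that $f_1\perp_{\mathbf{C}}f_2$ if and only if $j(f_1)\perp_{\mathbf{D}}j(f_2)$. Let $W$ be a set of morphisms of $\mathbf{C}$. Post-composition with the pullback functor $\phi^*:\mathbf{Alg}_{\mathcal{Q}}\to\mathbf{Alg}_{\mathcal{P}}$ gives functors $(\phi^*)_*:\mathbf{FT}(\overline{\mathbf{E}},\mathcal{Q}^{(s_1,s_2)})\to\mathbf{FT}(\overline{\mathbf{E}},\mathcal{P}^{(r_1,r_2)})$ for $\mathbf{E}=\mathbf{C},\mathbf{D}$, and pre-composition with $j$ gives functors $j^*:\mathbf{FT}(\overline{\mathbf{D}},\mathcal{O})\to\mathbf{FT}(\overline{\mathbf{C}},\mathcal{O})$ for $\mathcal{O}=\mathcal{P}^{(r_1,r_2)},\mathcal{Q}^{(s_1,s_2)}$.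 All of these functors have left adjoints, denoted $(\phi^*)^!$ and $j_!$ respectively. A field theory $\mathfrak{A}$ on $\overline{\mathbf{D}}$ is called *$j$-local* if the counit $j_!\,j^*(\mathfrak{A})\to\mathfrak{A}$ is an isomorphism; a field theory $\mathfrak{A}$ on $\overline{\mathbf{C}}$ is called *$W$-constant* if $\mathfrak{A}(f)$ is an isomorphism for every $f\in W$. Then: a) The left adjoint $(\phi^*)^!:\mathbf{FT}(\overline{\mathbf{D}},\mathcal{P}^{(r_1,r_2)})\to\mathbf{FT}(\overline{\mathbf{D}},\mathcal{Q}^{(s_1,s_2)})$ maps $j$-local field theories to $j$-local field theories. b) The right adjoint $(\phi^*)_*:\mathbf{FT}(\overline{\mathbf{C}},\mathcal{Q}^{(s_1,s_2)})\to\mathbf{FT}(\overline{\mathbf{C}},\mathcal{P}^{(r_1,r_2)})$ maps $W$-constant field theories to $W$-constant field theories. -/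

import Mathlib

open CategoryTheory MonoidalCategory Limits

universe v u

namespace OperadicFT

/-! ### Ordered tensor products of finite families -/

section Tensor

variable {M : Type u} [Category.{v} M] [MonoidalCategory M]

/-- The tensor product `X a₁ ⊗ (X a₂ ⊗ (⋯ ⊗ (X aₙ ⊗ 𝟙_)))` of a family `X` along a list
`[a₁, …, aₙ]` of indices. -/
@[reducible]
def tens {ι : Type} (X : ι → M) : List ι → M
  | [] => 𝟙_ M
  | a :: l => X a ⊗ tens X l

/-- Functoriality of `tens` in the family. -/
def tensMap {ι : Type} {X Y : ι → M} (f : ∀ i, X i ⟶ Y i) :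
    (l : List ι) → (tens X l ⟶ tens Y l)
  | [] => 𝟙 _
  | a :: l => f a ⊗ₘ tensMap f l

/-- The tensor product of a family of morphisms `𝟙_ ⟶ X i`. -/
def tensElt {ι : Type} {X : ι → M} (x : ∀ i, 𝟙_ M ⟶ X i) :
    (l : List ι) → (𝟙_ M ⟶ tens X l)
  | [] => 𝟙 _
  | a :: l => (λ_ (𝟙_ M)).inv ≫ (x a ⊗ₘ tensElt x l)

/-- The canonical morphism (an iterated associator) for concatenated lists. -/
def tensAppend {ι : Type} (X : ι → M) :
    (l l' : List ι) → (tens X l ⊗ tens X l' ⟶ tens X (l ++ l'))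
  | [], l' => (λ_ (tens X l')).hom
  | a :: l, l' => (α_ (X a) (tens X l) (tens X l')).hom ≫ X a ◁ tensAppend X l l'

/-- The tensor product of `X ∘ e` along `l` is that of `X` along `l.map e`. -/
def tensToMap {ι κ : Type} (X : ι → M) (e : κ → ι) :
    (l : List κ) → (tens (fun k => X (e k)) l ⟶ tens X (l.map e))
  | [] => 𝟙 _
  | a :: l => X (e a) ◁ tensToMap X e l

/-- The inverse of `tensToMap`. -/
def tensFromMap {ι κ : Type} (X : ι → M) (e : κ → ι) :
    (l : List κ) → (tens X (l.map e) ⟶ tens (fun k => X (e k)) l)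
  | [] => 𝟙 _
  | a :: l => X (e a) ◁ tensFromMap X e l

/-- The canonical morphism from an iterated tensor product to a single one,
in lexicographic order. -/
def tensSigma {ι : Type} {κ : ι → Type} (X : ∀ i, κ i → M) (K : ∀ i, List (κ i)) :
    (l : List ι) → (tens (fun i => tens (X i) (K i)) l ⟶
      tens (fun p : (i : ι) × κ i => X p.1 p.2) (l.sigma K))
  | [] => 𝟙 _
  | i :: l => (tensToMap (fun p : (i : ι) × κ i => X p.1 p.2) (Sigma.mk i) (K i) ⊗ₘ
      tensSigma X K l) ≫ tensAppend _ _ _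

lemma tensMap_id {ι : Type} (X : ι → M) (l : List ι) :
    tensMap (fun i => 𝟙 (X i)) l = 𝟙 (tens X l) := by
  induction l with
  | nil => rfl
  | cons a l ih => simp [tensMap, ih, tens]

lemma tensMap_comp {ι : Type} {X Y Z : ι → M} (f : ∀ i, X i ⟶ Y i) (g : ∀ i, Y i ⟶ Z i)
    (l : List ι) : tensMap (fun i => f i ≫ g i) l = tensMap f l ≫ tensMap g l := by
  induction l with
  | nil => simp [tensMap]
  | cons a l ih => simp [tensMap, ih]

variable [SymmetricCategory M]

/-- The shuffle `⨂ (X i ⊗ Y i) ⟶ (⨂ X i) ⊗ (⨂ Y i)`. -/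
def tensZip {ι : Type} (X Y : ι → M) :
    (l : List ι) → (tens (fun i => X i ⊗ Y i) l ⟶ tens X l ⊗ tens Y l)
  | [] => (λ_ (𝟙_ M)).inv
  | a :: l => (X a ⊗ Y a) ◁ tensZip X Y l ≫ tensorμ (X a) (Y a) (tens X l) (tens Y l)

/-- Moving the (first) factor indexed by `a` to the front, by means of the braiding. -/
def tensPull {ι : Type} [DecidableEq ι] (X : ι → M) (a : ι) :
    (l : List ι) → a ∈ l → (tens X l ⟶ X a ⊗ tens X (l.erase a))
  | [], h => absurd h List.not_mem_nil
  | b :: l, h =>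
    if hb : b = a then
      eqToHom (by subst hb; rw [List.erase_cons_head])
    else
      X b ◁ tensPull X a l ((List.mem_cons.1 h).resolve_left (Ne.symm hb)) ≫
        (α_ (X b) (X a) (tens X (l.erase a))).inv ≫
        (β_ (X b) (X a)).hom ▷ tens X (l.erase a) ≫
        (α_ (X a) (X b) (tens X (l.erase a))).hom ≫
        X a ◁ eqToHom (by rw [List.erase_cons_tail (by simpa using hb)])

/-- The symmetry isomorphism between the tensor products along two lists that are permutations of
each other. It is the expected one if the lists have no duplicates, the only case used below. -/
def tensPerm {ι : Type} [DecidableEq ι] (X : ι → M) :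
    (l l' : List ι) → l.Perm l' → (tens X l ⟶ tens X l')
  | l, [], h => eqToHom (by rw [h.eq_nil])
  | l, a :: l', h =>
    tensPull X a l (h.mem_iff.2 List.mem_cons_self) ≫
      X a ◁ tensPerm X (l.erase a) l'
        (List.cons_perm_iff_perm_erase.1 h.symm).2.symm

/-- The tensor product `X 0 ⊗ ⋯ ⊗ X (n-1)`. -/
abbrev finTens {n : ℕ} (X : Fin n → M) : M := tens X (List.finRange n)

/-- The tensor power `A ⊗ ⋯ ⊗ A`. -/
abbrev tensPow (n : ℕ) (A : M) : M := finTens (fun _ : Fin n => A)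

/-- The identification of `A` with its first tensor power. -/
def tensOne (A : M) : A ⟶ tensPow 1 A := (ρ_ A).inv

/-- The identification of `A ⊗ A` with the second tensor power. -/
def tensTwo (A : M) : A ⊗ A ⟶ tensPow 2 A := A ◁ (ρ_ A).inv

/-- The permutation `⨂ᵢ X i ⟶ ⨂ᵢ X (σ i)` of tensor factors. -/
def finTensPerm {n : ℕ} (σ : Equiv.Perm (Fin n)) (X : Fin n → M) :
    finTens X ⟶ finTens (fun i => X (σ i)) :=
  tensPerm X (List.finRange n) ((List.finRange n).map σ)
      (by
        refine (List.perm_ext_iff_of_nodup (List.nodup_finRange n)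
          ((List.nodup_finRange n).map σ.injective)).2 fun i => ?_
        simp only [List.mem_finRange, List.mem_map, true_and, true_iff]
        exact ⟨σ.symm i, σ.apply_symm_apply i⟩) ≫
    tensFromMap X σ (List.finRange n)

/-- The canonical morphism `⨂ᵢ ⨂ⱼ X i j ⟶ ⨂ₐ X aᵢ aⱼ`, where `a` enumerates the pairs `(i, j)`
lexicographically. -/
def finTensFlatten {n : ℕ} {k : Fin n → ℕ} (X : ∀ i, Fin (k i) → M) :
    finTens (fun i => finTens (X i)) ⟶
      finTens (fun a : Fin (∑ i, k i) =>
        X (finSigmaFinEquiv.symm a).1 (finSigmaFinEquiv.symm a).2) :=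
  tensSigma X (fun i => List.finRange (k i)) (List.finRange n) ≫
    tensPerm (fun p : (i : Fin n) × Fin (k i) => X p.1 p.2)
      ((List.finRange n).sigma fun i => List.finRange (k i))
      ((List.finRange (∑ i, k i)).map finSigmaFinEquiv.symm)
      (by
        refine (List.perm_ext_iff_of_nodup
          ((List.nodup_finRange n).sigma fun i => List.nodup_finRange (k i))
          ((List.nodup_finRange _).map finSigmaFinEquiv.symm.injective)).2 fun p => ?_
        refine iff_of_true ?_ (List.mem_map.2 ⟨finSigmaFinEquiv p, List.mem_finRange _,
          finSigmaFinEquiv.symm_apply_apply p⟩)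
        exact List.mem_sigma.2 ⟨List.mem_finRange _, List.mem_finRange _⟩) ≫
    tensFromMap (fun p : (i : Fin n) × Fin (k i) => X p.1 p.2) finSigmaFinEquiv.symm
      (List.finRange (∑ i, k i))

/-- The shuffle `⨂ᵢ (X i ⊗ Y i) ⟶ (⨂ᵢ X i) ⊗ (⨂ᵢ Y i)`. -/
abbrev finTensZip {n : ℕ} (X Y : Fin n → M) :
    finTens (fun i => X i ⊗ Y i) ⟶ finTens X ⊗ finTens Y :=
  tensZip X Y (List.finRange n)

lemma tensZip_natural {ι : Type} {X X' Y Y' : ι → M} (f : ∀ i, X i ⟶ X' i)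
    (g : ∀ i, Y i ⟶ Y' i) (l : List ι) :
    tensMap (fun i => f i ⊗ₘ g i) l ≫ tensZip X' Y' l =
      tensZip X Y l ≫ (tensMap f l ⊗ₘ tensMap g l) := by
  induction l with
  | nil => simp [tensMap, tensZip]
  | cons a l ih =>
    simp only [tensMap, tensZip, Category.assoc]
    rw [← tensorμ_natural, ← MonoidalCategory.id_tensorHom,
      ← MonoidalCategory.id_tensorHom, MonoidalCategory.tensorHom_comp_tensorHom_assoc,
      MonoidalCategory.tensorHom_comp_tensorHom_assoc, ih, Category.comp_id, Category.id_comp]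

end Tensor

/-! ### Single-colored operads -/

section Operads

/-- The block permutation of `k (σ 0) + k (σ 1) + ⋯` letters induced by `σ`, sending the `j`-th
letter of the `i`-th block to the `j`-th letter of the `σ i`-th block. -/
def blockPerm {n : ℕ} (σ : Equiv.Perm (Fin n)) (k : Fin n → ℕ) :
    Fin (∑ i, k (σ i)) ≃ Fin (∑ i, k i) :=
  (finSigmaFinEquiv (n := fun i => k (σ i))).symm.trans
    ((Equiv.sigmaCongrLeft (β := fun i => Fin (k i)) σ).trans finSigmaFinEquiv)

/-- `blockPerm` as a permutation of `k 0 + k 1 + ⋯` letters. -/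
def blockPerm' {n : ℕ} (σ : Equiv.Perm (Fin n)) (k : Fin n → ℕ) :
    Equiv.Perm (Fin (∑ i, k i)) :=
  (finCongr (Equiv.sum_comp σ k).symm).trans (blockPerm σ k)

/-- The block sum `τ 0 ⊕ τ 1 ⊕ ⋯` of permutations. -/
def sumPerm {n : ℕ} {k : Fin n → ℕ} (τ : ∀ i, Equiv.Perm (Fin (k i))) :
    Equiv.Perm (Fin (∑ i, k i)) :=
  finSigmaFinEquiv.symm.trans ((Equiv.sigmaCongrRight τ).trans finSigmaFinEquiv)

/-- The lengths of the inner blocks, enumerated lexicographically. -/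
abbrev flatLen {n : ℕ} {k : Fin n → ℕ} (l : ∀ i, Fin (k i) → ℕ) (a : Fin (∑ i, k i)) : ℕ :=
  l (finSigmaFinEquiv.symm a).1 (finSigmaFinEquiv.symm a).2

lemma sum_flatLen {n : ℕ} {k : Fin n → ℕ} (l : ∀ i, Fin (k i) → ℕ) :
    ∑ a, flatLen l a = ∑ i, ∑ j, l i j := by
  rw [← Fintype.sum_sigma']
  exact Equiv.sum_comp finSigmaFinEquiv.symm (fun p : (i : Fin n) × Fin (k i) => l p.1 p.2)

variable (M : Type u) [Category.{v} M] [MonoidalCategory M] [SymmetricCategory M]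

/-- A single-colored (symmetric) operad with values in `M`: objects of operations `ob n`, a right
action of the permutation groups, operadic compositions and an operadic unit, subject to the usual
axioms. For `n = 0` the composition is forced by `unit_right` to be the right unitor. -/
structure Operad where
  /-- the object `P(n)` of operations of arity `n` -/
  ob : ℕ → M
  /-- the permutation action `P(σ)`: in terms of elements, `x ↦ x · σ` -/
  perm : ∀ {n : ℕ}, Equiv.Perm (Fin n) → (ob n ⟶ ob n)
  /-- the operadic composition -/
  comp : ∀ {n : ℕ} (k : Fin n → ℕ), ob n ⊗ finTens (fun i => ob (k i)) ⟶ ob (∑ i, k i)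
  /-- the operadic unit -/
  unit : 𝟙_ M ⟶ ob 1
  perm_one : ∀ n : ℕ, perm (1 : Equiv.Perm (Fin n)) = 𝟙 (ob n)
  perm_mul : ∀ {n : ℕ} (σ τ : Equiv.Perm (Fin n)), perm (σ * τ) = perm σ ≫ perm τ
  /-- `γ(x · σ; y_{σ 0}, y_{σ 1}, …) = γ(x; y₀, y₁, …) · σ⟨k₀, k₁, …⟩` -/
  comp_perm : ∀ {n : ℕ} (σ : Equiv.Perm (Fin n)) (k : Fin n → ℕ),
    (perm σ ⊗ₘ finTensPerm σ (fun i => ob (k i))) ≫ comp (fun i => k (σ i)) =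
      comp k ≫ perm (blockPerm' σ k) ≫ eqToHom (congrArg ob (Equiv.sum_comp σ k).symm)
  /-- `γ(x; y₀ · τ₀, y₁ · τ₁, …) = γ(x; y₀, y₁, …) · (τ₀ ⊕ τ₁ ⊕ ⋯)` -/
  comp_sumPerm : ∀ {n : ℕ} {k : Fin n → ℕ} (τ : ∀ i, Equiv.Perm (Fin (k i))),
    ob n ◁ tensMap (fun i => perm (τ i)) (List.finRange n) ≫ comp k = comp k ≫ perm (sumPerm τ)
  /-- `γ(x; γ(y₀; z₀₀, …), γ(y₁; z₁₀, …), …) = γ(γ(x; y₀, y₁, …); z₀₀, …, z₁₀, …)` -/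
  assoc : ∀ {n : ℕ} {k : Fin n → ℕ} (l : ∀ i, Fin (k i) → ℕ),
    ob n ◁ tensMap (fun i => comp (l i)) (List.finRange n) ≫ comp (fun i => ∑ j, l i j) =
      ob n ◁ finTensZip (fun i => ob (k i)) (fun i => finTens fun j => ob (l i j)) ≫
        (α_ _ _ _).inv ≫
        (comp k ⊗ₘ finTensFlatten (fun i j => ob (l i j))) ≫
        comp (flatLen l) ≫ eqToHom (congrArg ob (sum_flatLen l))
  /-- `γ(1; x) = x` -/
  unit_left : ∀ k : ℕ,
    (λ_ (ob k)).inv ≫ (unit ⊗ₘ tensOne (ob k)) ≫ comp (fun _ : Fin 1 => k) =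
      eqToHom (congrArg ob (by simp))
  /-- `γ(x; 1, …, 1) = x` -/
  unit_right : ∀ n : ℕ,
    (ρ_ (ob n)).inv ≫ ob n ◁ tensElt (fun _ => unit) (List.finRange n) ≫
      comp (fun _ : Fin n => 1) = eqToHom (congrArg ob (by simp))

variable {M}

/-- A morphism of single-colored operads. -/
@[ext]
structure Operad.Hom (P Q : Operad M) where
  app : ∀ n : ℕ, P.ob n ⟶ Q.ob n
  perm : ∀ {n : ℕ} (σ : Equiv.Perm (Fin n)), P.perm σ ≫ app n = app n ≫ Q.perm σ
  comp : ∀ {n : ℕ} (k : Fin n → ℕ),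
    P.comp k ≫ app (∑ i, k i) =
      (app n ⊗ₘ tensMap (fun i => app (k i)) (List.finRange n)) ≫ Q.comp k
  unit : P.unit ≫ app 1 = Q.unit

/-- An algebra over a single-colored operad. -/
structure Alg (P : Operad M) where
  /-- the underlying object -/
  carrier : M
  /-- the action of the operad -/
  act : ∀ n : ℕ, P.ob n ⊗ tensPow n carrier ⟶ carrier
  assoc : ∀ {n : ℕ} (k : Fin n → ℕ),
    P.ob n ◁ tensMap (fun i => act (k i)) (List.finRange n) ≫ act n =
      P.ob n ◁ finTensZip (fun i => P.ob (k i)) (fun i => tensPow (k i) carrier) ≫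
        (α_ _ _ _).inv ≫
        (P.comp k ⊗ₘ finTensFlatten (fun (i : Fin n) (_ : Fin (k i)) => carrier)) ≫
        act (∑ i, k i)
  unit : (λ_ carrier).inv ≫ (P.unit ⊗ₘ tensOne carrier) ≫ act 1 = 𝟙 carrier
  equivariance : ∀ {n : ℕ} (σ : Equiv.Perm (Fin n)),
    (P.perm σ ⊗ₘ finTensPerm σ (fun _ => carrier)) ≫ act n = act n

namespace Alg

/-- A morphism of algebras over a single-colored operad. -/
@[ext]
structure Hom {P : Operad M} (A B : Alg P) where
  hom : A.carrier ⟶ B.carrier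
  act_hom : ∀ n : ℕ,
    A.act n ≫ hom = P.ob n ◁ tensMap (fun _ => hom) (List.finRange n) ≫ B.act n

/-- The category of algebras over a single-colored operad. -/
instance category (P : Operad M) : Category.{v} (Alg P) where
  Hom A B := Hom A B
  id A := ⟨𝟙 _, fun n => by simp [tensMap_id]⟩
  comp f g := ⟨f.hom ≫ g.hom, fun n => by
    rw [← Category.assoc, f.act_hom, Category.assoc, g.act_hom, tensMap_comp]
    simp⟩

@[ext]
lemma hom_ext {P : Operad M} {A B : Alg P} (f g : A ⟶ B) (h : f.hom = g.hom) : f = g :=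
  Hom.ext h

@[simp]
lemma id_hom {P : Operad M} (A : Alg P) : Hom.hom (𝟙 A) = 𝟙 A.carrier := rfl

@[simp]
lemma comp_hom {P : Operad M} {A B C : Alg P} (f : A ⟶ B) (g : B ⟶ C) :
    (f ≫ g).hom = f.hom ≫ g.hom := rfl

end Alg

/-- The pullback of an algebra along a morphism `φ` of operads. -/
def Alg.pullback {P Q : Operad M} (φ : Operad.Hom P Q) (A : Alg Q) : Alg P where
  carrier := A.carrier
  act n := φ.app n ▷ tensPow n A.carrier ≫ A.act n
  assoc := by
    intro n k
    have h1 : tensMap (fun i => φ.app (k i) ▷ tensPow (k i) A.carrier ≫ A.act (k i))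
        (List.finRange n) =
        tensMap (fun i => φ.app (k i) ⊗ₘ 𝟙 (tensPow (k i) A.carrier)) (List.finRange n) ≫
          tensMap (fun i => A.act (k i)) (List.finRange n) := by
      rw [← tensMap_comp]; simp
    have h2 := tensZip_natural (fun i => φ.app (k i))
      (fun i => 𝟙 (tensPow (k i) A.carrier)) (List.finRange n)
    rw [tensMap_id, MonoidalCategory.tensorHom_id] at h2
    have h3 := φ.comp k
    have h4 := A.assoc k
    calc _ = (φ.app n ⊗ₘ tensMap (fun i => φ.app (k i) ⊗ₘ 𝟙 (tensPow (k i) A.carrier))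
              (List.finRange n)) ≫
            Q.ob n ◁ tensMap (fun i => A.act (k i)) (List.finRange n) ≫ A.act n := by
          rw [h1, MonoidalCategory.tensorHom_def']
          simp only [MonoidalCategory.whiskerLeft_comp, Category.assoc,
            MonoidalCategory.whisker_exchange_assoc]
      _ = P.ob n ◁ finTensZip (fun i => P.ob (k i)) (fun i => tensPow (k i) A.carrier) ≫
            (φ.app n ⊗ₘ (tensMap (fun i => φ.app (k i)) (List.finRange n) ▷
              finTens (fun i => tensPow (k i) A.carrier))) ≫
            (α_ _ _ _).inv ≫
            (Q.comp k ⊗ₘ finTensFlatten (fun (i : Fin n) (_ : Fin (k i)) => A.carrier)) ≫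
            A.act (∑ i, k i) := by
          rw [h4, MonoidalCategory.tensorHom_def', MonoidalCategory.tensorHom_def']
          simp only [Category.assoc, ← MonoidalCategory.whisker_exchange_assoc]
          rw [← MonoidalCategory.whiskerLeft_comp_assoc, h2]
          simp only [MonoidalCategory.whiskerLeft_comp, Category.assoc]
          rw [MonoidalCategory.tensorHom_def (φ.app n), Category.assoc,
            MonoidalCategory.whisker_exchange_assoc]
      _ = _ := by
          congr 1
          rw [← MonoidalCategory.tensorHom_id, MonoidalCategory.associator_inv_naturality_assoc,
            MonoidalCategory.tensorHom_comp_tensorHom_assoc, ← h3, Category.id_comp,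
            MonoidalCategory.tensorHom_def, MonoidalCategory.tensorHom_def]
          simp only [MonoidalCategory.comp_whiskerRight, Category.assoc,
            MonoidalCategory.whisker_exchange_assoc]
  unit := by
    have h := A.unit
    rw [← φ.unit] at h
    rw [← h]
    simp only [MonoidalCategory.tensorHom_def, MonoidalCategory.comp_whiskerRight, Category.assoc,
      MonoidalCategory.whisker_exchange_assoc]
  equivariance := by
    intro n σ
    conv_rhs => rw [← A.equivariance σ]
    rw [MonoidalCategory.tensorHom_def, MonoidalCategory.tensorHom_def, Category.assoc,
      Category.assoc, MonoidalCategory.whisker_exchange_assoc,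
      ← MonoidalCategory.comp_whiskerRight_assoc,
      ← MonoidalCategory.comp_whiskerRight_assoc, φ.perm σ]

/-- The pullback functor `φ^*` on algebras along a morphism `φ` of operads. -/
def pullbackAlg {P Q : Operad M} (φ : Operad.Hom P Q) : Alg Q ⥤ Alg P where
  obj A := A.pullback φ
  map {A B} f :=
    { hom := f.hom
      act_hom := fun n => by
        have h := f.act_hom n
        simp only [Alg.pullback, Category.assoc]
        rw [h, MonoidalCategory.whisker_exchange_assoc] }

variable (M) in
/-- An (arity `2`) bipointed single-colored operad: an operad `P` with two operations
`r₁, r₂ : 𝟙_ ⟶ P(2)` of arity two. -/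
structure BipointedOperad extends Operad M where
  r₁ : 𝟙_ M ⟶ ob 2
  r₂ : 𝟙_ M ⟶ ob 2

/-- A morphism of bipointed single-colored operads. -/
@[ext]
structure BipointedOperad.Hom (P Q : BipointedOperad M) extends
    Operad.Hom P.toOperad Q.toOperad where
  map_r₁ : P.r₁ ≫ app 2 = Q.r₁
  map_r₂ : P.r₂ ≫ app 2 = Q.r₂

end Operads

/-! ### Orthogonal categories -/

/-- An orthogonality relation on a category: a symmetric relation on pairs of morphisms with
common target that is stable under composition. -/
structure Orthogonality (C : Type v) [SmallCategory C] where
  /-- `rel f₁ f₂` means `f₁ ⊥ f₂` -/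
  rel : ∀ {c₁ c₂ c : C}, (c₁ ⟶ c) → (c₂ ⟶ c) → Prop
  symm : ∀ {c₁ c₂ c : C} (f₁ : c₁ ⟶ c) (f₂ : c₂ ⟶ c), rel f₁ f₂ → rel f₂ f₁
  comp : ∀ {c₁ c₂ c b₁ b₂ d : C} (f₁ : c₁ ⟶ c) (f₂ : c₂ ⟶ c) (g : c ⟶ d) (h₁ : b₁ ⟶ c₁)
    (h₂ : b₂ ⟶ c₂), rel f₁ f₂ → rel (h₁ ≫ f₁ ≫ g) (h₂ ≫ f₂ ≫ g)

/-- A full orthogonal subcategory, given by its embedding: a fully faithful functor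
`j : C ⥤ D` such that `⊥_C` is the pullback of `⊥_D` along `j`. -/
structure IsFullOrthogonalSubcategory {C D : Type v} [SmallCategory C] [SmallCategory D]
    (oC : Orthogonality C) (oD : Orthogonality D) (j : C ⥤ D) : Prop where
  full : j.Full
  faithful : j.Faithful
  rel_iff : ∀ {c₁ c₂ c : C} (f₁ : c₁ ⟶ c) (f₂ : c₂ ⟶ c),
    oC.rel f₁ f₂ ↔ oD.rel (j.map f₁) (j.map f₂)

/-! ### Field theories -/

section FieldTheories

variable {M : Type u} [Category.{v} M] [MonoidalCategory M] [SymmetricCategory M]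

/-- The condition that a functor `𝔄 : C ⥤ Alg P` is a field theory: for all
`(f₁ : c₁ ⟶ c) ⊥ (f₂ : c₂ ⟶ c)`, the two composites
`𝟙_ ⊗ (𝔄 c₁ ⊗ 𝔄 c₂) ⟶ P(2) ⊗ (𝔄 c)^{⊗ 2} ⟶ 𝔄 c` given by `rᵢ ⊗ 𝔄 f₁ ⊗ 𝔄 f₂` and the action
of `P` are equal. -/
def isFieldTheory {C : Type v} [SmallCategory C] (oC : Orthogonality C)
    (P : BipointedOperad M) : ObjectProperty (C ⥤ Alg P.toOperad) := fun 𝔄 =>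
  ∀ ⦃c₁ c₂ c : C⦄ (f₁ : c₁ ⟶ c) (f₂ : c₂ ⟶ c), oC.rel f₁ f₂ →
    (P.r₁ ⊗ₘ (((𝔄.map f₁).hom ⊗ₘ (𝔄.map f₂).hom) ≫ tensTwo (𝔄.obj c).carrier)) ≫
        (𝔄.obj c).act 2 =
      (P.r₂ ⊗ₘ (((𝔄.map f₁).hom ⊗ₘ (𝔄.map f₂).hom) ≫ tensTwo (𝔄.obj c).carrier)) ≫
        (𝔄.obj c).act 2

/-- The category `FT(C, P)` of field theories, a full subcategory of `C ⥤ Alg P`. -/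
abbrev FT {C : Type v} [SmallCategory C] (oC : Orthogonality C) (P : BipointedOperad M) :=
  (isFieldTheory oC P).FullSubcategory

/-- The functor `(φ^*)_* = φ^* ∘ (-) : FT(C, Q) ⥤ FT(C, P)`. -/
def changeOperad {C : Type v} [SmallCategory C] (oC : Orthogonality C)
    {P Q : BipointedOperad M} (φ : BipointedOperad.Hom P Q) : FT oC Q ⥤ FT oC P :=
  (isFieldTheory oC P).lift
    ((isFieldTheory oC Q).ι ⋙ (Functor.whiskeringRight C _ _).obj (pullbackAlg φ.toHom))
    (fun 𝔄 c₁ c₂ c f₁ f₂ h => by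
      have h' := 𝔄.property f₁ f₂ h
      rw [← φ.map_r₁, ← φ.map_r₂] at h'
      have key : ∀ {X Y : M} (r : 𝟙_ M ⟶ P.ob 2) (g : X ⟶ Y),
          (r ⊗ₘ g) ≫ φ.app 2 ▷ Y = (r ≫ φ.app 2) ⊗ₘ g := fun r g => by
        rw [← MonoidalCategory.tensorHom_id, MonoidalCategory.tensorHom_comp_tensorHom,
          Category.comp_id]
      rw [← key, ← key, Category.assoc, Category.assoc] at h'
      exact h')

/-- The restriction functor `j^* = (-) ∘ j : FT(D, P) ⥤ FT(C, P)` along a full orthogonal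
subcategory `j`. -/
def restrict {C D : Type v} [SmallCategory C] [SmallCategory D]
    {oC : Orthogonality C} {oD : Orthogonality D} {j : C ⥤ D}
    (hj : IsFullOrthogonalSubcategory oC oD j) (P : BipointedOperad M) : FT oD P ⥤ FT oC P :=
  (isFieldTheory oC P).lift
    ((isFieldTheory oD P).ι ⋙ (Functor.whiskeringLeft C D _).obj j)
    (fun 𝔄 _ _ _ f₁ f₂ h => 𝔄.property (j.map f₁) (j.map f₂) ((hj.rel_iff f₁ f₂).1 h))

/-- A field theory `𝔄` on `D` is `j`-local if the counit `j_! j^* 𝔄 ⟶ 𝔄` of the adjunction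
`j_! ⊣ j^*` is an isomorphism. (Left adjoints being unique up to a unique isomorphism, this does
not depend on the choice of the adjunction.) -/
def IsLocal {C D : Type v} [SmallCategory C] [SmallCategory D]
    {oC : Orthogonality C} {oD : Orthogonality D} {j : C ⥤ D}
    (hj : IsFullOrthogonalSubcategory oC oD j) {P : BipointedOperad M} (𝔄 : FT oD P) : Prop :=
  ∃ (L : FT oC P ⥤ FT oD P) (adj : L ⊣ restrict hj P), IsIso (adj.counit.app 𝔄)

/-- A field theory `𝔄` on `C` is `W`-constant if `𝔄 f` is an isomorphism of algebras for every
`f` in `W`. -/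
def IsConstantOn {C : Type v} [SmallCategory C] {oC : Orthogonality C} {P : BipointedOperad M}
    (W : MorphismProperty C) (𝔄 : FT oC P) : Prop :=
  ∀ ⦃c c' : C⦄ (f : c ⟶ c'), W f → IsIso (𝔄.obj.map f)

end FieldTheories

end OperadicFT

/-!
Taking left adjoints of `j^* (φ^*)_* = (φ^*)_* j^*` gives `(φ^*)^! j_! ≅ j_! (φ^*)^!`. Hence
`(φ^*)^!` sends a `j`-local field theory, which is of the form `j_! 𝔅`, to `j_!` of a field theory
on `C`. It remains to see that the counit of `j_! ⊣ j^*` is an isomorphism at every `j_! 𝔅`, for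
which it suffices that the unit `𝔅 ⟶ j^* j_! 𝔅` is an epimorphism. The functors `j_!` and `j^*`
preserve reflexive coequalizers, and every field theory is a reflexive coequalizer of free ones, so
`𝔅` may be taken to be free on a diagram `G` of objects. Then `j_! 𝔅` is the free field theory on
the left Kan extension `Lan G`, which is a quotient of the free diagram of algebras on `Lan G`; as
`j^* Lan G ≅ G`, its restriction along `j` is a quotient of the free diagram of algebras on `G`.

The left adjoints exist because operad algebras and field theories are given by operations and
equations. The free algebra on an endofunctor preserving sifted colimits is constructed as a colimit
of a chain; imposing equations on a free object is a reflexive coequalizer, preserved by the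
forgetful functor; and a coequalizer of a relation is again a model of the equations, because the
inputs of the equations preserve epimorphisms.
-/

namespace OperadicFT

section Sifted

open WalkingReflexivePair WalkingReflexivePair.Hom

lemma hom_zero_zero_eq (f f' : (zero : WalkingReflexivePair) ⟶ zero) : f = f' := by
  have h : ∀ e : WalkingReflexivePair.Hom zero zero, e = WalkingReflexivePair.Hom.id zero := by
    rintro ⟨⟩; rfl
  exact (h f).trans (h f').symm

lemma hom_one_zero_cases (f : (one : WalkingReflexivePair) ⟶ zero) : f = left ∨ f = right := by
  have h : ∀ e : WalkingReflexivePair.Hom one zero, e = left ∨ e = right := by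
    rintro (_ | _)
    exacts [Or.inl rfl, Or.inr rfl]
  exact h f

lemma zigzag_reflexive_left {a b : WalkingReflexivePair} (f f' : a ⟶ zero) (g : b ⟶ zero) :
    Zigzag (StructuredArrow.mk (T := Functor.diag WalkingReflexivePair) (S := (a, b)) (Y := zero)
      ((f, g) : (a, b) ⟶ (zero, zero)))
      (StructuredArrow.mk (Y := zero) ((f', g) : (a, b) ⟶ (zero, zero))) := by
  cases a with
  | zero => obtain rfl := hom_zero_zero_eq f f'; exact Relation.ReflTransGen.refl
  | one =>
    let m : StructuredArrow (one, b) (Functor.diag WalkingReflexivePair) :=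
      StructuredArrow.mk (Y := one) ((𝟙 one, g ≫ reflexion) : (one, b) ⟶ (one, one))
    have h : ∀ e : one ⟶ zero, Zigzag m (StructuredArrow.mk (Y := zero)
        ((e, g) : (one, b) ⟶ (zero, zero))) := by
      intro e
      refine Zigzag.of_hom (StructuredArrow.homMk e ?_)
      obtain rfl | rfl := hom_one_zero_cases e <;> exact Prod.ext (Category.id_comp _) (by simp [m])
    exact (h f).symm.trans (h f')

lemma zigzag_reflexive_right {a b : WalkingReflexivePair} (f : a ⟶ zero) (g g' : b ⟶ zero) :
    Zigzag (StructuredArrow.mk (T := Functor.diag WalkingReflexivePair) (S := (a, b)) (Y := zero)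
      ((f, g) : (a, b) ⟶ (zero, zero)))
      (StructuredArrow.mk (Y := zero) ((f, g') : (a, b) ⟶ (zero, zero))) := by
  cases b with
  | zero => obtain rfl := hom_zero_zero_eq g g'; exact Relation.ReflTransGen.refl
  | one =>
    let m : StructuredArrow (a, one) (Functor.diag WalkingReflexivePair) :=
      StructuredArrow.mk (Y := one) ((f ≫ reflexion, 𝟙 one) : (a, one) ⟶ (one, one))
    have h : ∀ e : one ⟶ zero, Zigzag m (StructuredArrow.mk (Y := zero)
        ((f, e) : (a, one) ⟶ (zero, zero))) := by
      intro e
      refine Zigzag.of_hom (StructuredArrow.homMk e ?_)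
      obtain rfl | rfl := hom_one_zero_cases e <;> exact Prod.ext (by simp [m]) (Category.id_comp _)
    exact (h g).symm.trans (h g')

instance isSifted_walkingReflexivePair : IsSifted WalkingReflexivePair where
  nonempty := ⟨zero⟩
  out := by
    rintro ⟨a, b⟩
    have toZero : ∀ c : WalkingReflexivePair, Nonempty (c ⟶ zero) := fun c => by
      cases c
      exacts [⟨𝟙 _⟩, ⟨left⟩]
    have : Nonempty (StructuredArrow (a, b) (Functor.diag WalkingReflexivePair)) :=
      ⟨StructuredArrow.mk (Y := zero) (((toZero a).some, (toZero b).some) : (a, b) ⟶ (zero, zero))⟩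
    have zigzag_mk_zero : ∀ X : StructuredArrow (a, b) (Functor.diag WalkingReflexivePair),
        ∃ (f : a ⟶ zero) (g : b ⟶ zero), Zigzag X (StructuredArrow.mk (Y := zero)
          ((f, g) : (a, b) ⟶ (zero, zero))) := by
      rintro ⟨⟨⟨⟩⟩, c, f, g⟩
      obtain ⟨e⟩ := toZero c
      exact ⟨f ≫ e, g ≫ e, Zigzag.of_hom (StructuredArrow.homMk e rfl)⟩
    refine zigzag_isConnected fun X Y => ?_
    obtain ⟨f, g, h⟩ := zigzag_mk_zero X
    obtain ⟨f', g', h'⟩ := zigzag_mk_zero Y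
    exact h.trans ((zigzag_reflexive_left f f' g).trans
      ((zigzag_reflexive_right f' g g').trans h'.symm))

end Sifted

section TensorPowers

variable {M : Type u} [Category.{v} M] [MonoidalCategory M]

/-- The pointwise tensor product of the functors `F i`, with one factor for each entry of `l`. -/
def tensFunctor {N : Type*} [Category N] {ι : Type} (F : ι → N ⥤ M) (l : List ι) : N ⥤ M where
  obj X := tens (fun i => (F i).obj X) l
  map f := tensMap (fun i => (F i).map f) l
  map_id _ := by simp only [CategoryTheory.Functor.map_id, tensMap_id]
  map_comp _ _ := by simp only [CategoryTheory.Functor.map_comp, tensMap_comp]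

lemma epi_whiskerLeft [MonoidalClosed M] (X : M) {Y Z : M} (f : Y ⟶ Z) [Epi f] : Epi (X ◁ f) :=
  inferInstanceAs (Epi ((tensorLeft X).map f))

variable [SymmetricCategory M] [MonoidalClosed M]

instance preservesColimits_tensorRight (X : M) {J : Type*} [Category J] :
    PreservesColimitsOfShape J (tensorRight X) :=
  preservesColimitsOfShape_of_natIso (BraidedCategory.tensorLeftIsoTensorRight X)

instance preservesColimit_curriedTensor {J : Type*} [Category J] (K K' : J ⥤ M) :
    PreservesColimit₂ K K' (curriedTensor M) := by
  have h₁ : ∀ X : M, PreservesColimit K ((curriedTensor M).flip.obj X) := fun X =>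
    inferInstanceAs (PreservesColimit K (tensorRight X))
  have h₂ : ∀ X : M, PreservesColimit K' ((curriedTensor M).obj X) := fun X =>
    inferInstanceAs (PreservesColimit K' (tensorLeft X))
  infer_instance

instance preservesColimitsOfShape_tensFunctor {N : Type*} [Category N] {ι : Type}
    (F : ι → N ⥤ M) (l : List ι) {J : Type*} [Category J] [IsSifted J]
    [∀ i, PreservesColimitsOfShape J (F i)] :
    PreservesColimitsOfShape J (tensFunctor F l) := by
  induction l with
  | nil =>
    refine ⟨fun {K} => ⟨fun {c} _ => ⟨?_⟩⟩⟩
    exact (isColimitConstCocone J (𝟙_ M)).ofIsoColimit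
      (Cocone.ext (Iso.refl _) (fun j => Category.comp_id _))
  | cons a l ih =>
    refine ⟨fun {K} => ⟨fun {c} hc => ⟨?_⟩⟩⟩
    exact ((isColimitOfPreserves (F a) hc).tensor
      (isColimitOfPreserves (tensFunctor F l) hc)).ofIsoColimit
      (Cocone.ext (Iso.refl _) (fun j => Category.comp_id _))

lemma epi_tensorHom {X X' Y Y' : M} (f : X ⟶ X') (g : Y ⟶ Y') [Epi f] [Epi g] :
    Epi (f ⊗ₘ g) := by
  have : Epi (f ▷ Y) := inferInstanceAs (Epi ((tensorRight Y).map f))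
  have := epi_whiskerLeft X' g
  rw [MonoidalCategory.tensorHom_def]
  exact epi_comp _ _

lemma epi_tensMap {ι : Type} {X Y : ι → M} (f : ∀ i, X i ⟶ Y i) (h : ∀ i, Epi (f i))
    (l : List ι) : Epi (tensMap f l) := by
  induction l with
  | nil => exact inferInstanceAs (Epi (𝟙 _))
  | cons a l ih =>
    have := h a
    exact epi_tensorHom _ _

instance preservesEpimorphisms_tensFunctor {N : Type*} [Category N] {ι : Type} (F : ι → N ⥤ M)
    [∀ i, (F i).PreservesEpimorphisms] (l : List ι) : (tensFunctor F l).PreservesEpimorphisms where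
  preserves _ _ := epi_tensMap _ (fun _ => inferInstance) l

end TensorPowers

section Naturality

variable {M : Type u} [Category.{v} M] [MonoidalCategory M]

lemma tensorHom_whiskerLeft_comm {X Y A B A' B' : M} (f : X ⟶ Y) {p : A ⟶ B} {q : B ⟶ B'}
    {q' : A ⟶ A'} {p' : A' ⟶ B'} (h : p ≫ q = q' ≫ p') :
    (f ⊗ₘ p) ≫ Y ◁ q = X ◁ q' ≫ (f ⊗ₘ p') := by
  rw [← MonoidalCategory.id_tensorHom, ← MonoidalCategory.id_tensorHom,
    MonoidalCategory.tensorHom_comp_tensorHom, MonoidalCategory.tensorHom_comp_tensorHom, h,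
    Category.comp_id, Category.id_comp]

lemma tensorHom_whiskerLeft_map_comm {A B X X' Y Y' : M} (r : A ⟶ B) {f : X ⟶ Y} {u : Y ⟶ Y'}
    {u' : X ⟶ X'} {f' : X' ⟶ Y'} (h : f ≫ u = u' ≫ f') {Z : M} (a : B ⊗ Y' ⟶ Z) :
    A ◁ f ≫ (r ⊗ₘ u) ≫ a = (r ⊗ₘ u') ≫ B ◁ f' ≫ a := by
  rw [← MonoidalCategory.id_tensorHom, ← MonoidalCategory.id_tensorHom,
    MonoidalCategory.tensorHom_comp_tensorHom_assoc,
    MonoidalCategory.tensorHom_comp_tensorHom_assoc, h, Category.comp_id, Category.id_comp]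

lemma tensOne_natural {X Y : M} (f : X ⟶ Y) :
    f ≫ tensOne Y = tensOne X ≫ tensMap (fun _ => f) (List.finRange 1) :=
  (MonoidalCategory.rightUnitor_inv_naturality f).trans
    (congrArg ((ρ_ X).inv ≫ ·) (MonoidalCategory.tensorHom_id f (𝟙_ M)).symm)

lemma tensTwo_natural {X Y : M} (f : X ⟶ Y) :
    (f ⊗ₘ f) ≫ tensTwo Y = tensTwo X ≫ tensMap (fun _ => f) (List.finRange 2) :=
  tensorHom_whiskerLeft_comm f (tensOne_natural f)

lemma tensorHom_tensorHom_comm {A B A' B' C D C' D' E E' : M} {p₁ : A ⟶ B} {q₁ : B ⟶ B'}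
    {q₁' : A ⟶ A'} {p₁' : A' ⟶ B'} {p₂ : C ⟶ D} {q₂ : D ⟶ D'} {q₂' : C ⟶ C'} {p₂' : C' ⟶ D'}
    {s : B' ⊗ D' ⟶ E} {s' : A' ⊗ C' ⟶ E'} {t : E' ⟶ E}
    (h₁ : p₁ ≫ q₁ = q₁' ≫ p₁') (h₂ : p₂ ≫ q₂ = q₂' ≫ p₂') (h : (p₁' ⊗ₘ p₂') ≫ s = s' ≫ t) :
    (p₁ ⊗ₘ p₂) ≫ (q₁ ⊗ₘ q₂) ≫ s = ((q₁' ⊗ₘ q₂') ≫ s') ≫ t := by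
  rw [MonoidalCategory.tensorHom_comp_tensorHom_assoc, h₁, h₂,
    ← MonoidalCategory.tensorHom_comp_tensorHom_assoc, h, Category.assoc]

lemma tensAppend_natural {ι : Type} {X Y : ι → M} (f : ∀ i, X i ⟶ Y i) (l l' : List ι) :
    (tensMap f l ⊗ₘ tensMap f l') ≫ tensAppend Y l l' =
      tensAppend X l l' ≫ tensMap f (l ++ l') := by
  induction l with
  | nil => simp [tensAppend, tensMap]
  | cons a l ih =>
    simp only [tensAppend, tensMap, List.cons_append, Category.assoc]
    rw [MonoidalCategory.associator_naturality_assoc, tensorHom_whiskerLeft_comm _ ih]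

lemma tensToMap_natural {ι κ : Type} {X Y : ι → M} (f : ∀ i, X i ⟶ Y i) (e : κ → ι)
    (l : List κ) :
    tensMap (fun k => f (e k)) l ≫ tensToMap Y e l = tensToMap X e l ≫ tensMap f (l.map e) := by
  induction l with
  | nil => rfl
  | cons a l ih => exact tensorHom_whiskerLeft_comm _ ih

lemma tensFromMap_natural {ι κ : Type} {X Y : ι → M} (f : ∀ i, X i ⟶ Y i) (e : κ → ι)
    (l : List κ) :
    tensMap f (l.map e) ≫ tensFromMap Y e l =
      tensFromMap X e l ≫ tensMap (fun k => f (e k)) l := by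
  induction l with
  | nil => rfl
  | cons a l ih => exact tensorHom_whiskerLeft_comm _ ih

lemma tensSigma_natural {ι : Type} {κ : ι → Type} {X Y : ∀ i, κ i → M}
    (f : ∀ i j, X i j ⟶ Y i j) (K : ∀ i, List (κ i)) (l : List ι) :
    tensMap (fun i => tensMap (f i) (K i)) l ≫ tensSigma Y K l =
      tensSigma X K l ≫ tensMap (fun p : (i : ι) × κ i => f p.1 p.2) (l.sigma K) := by
  induction l with
  | nil => rfl
  | cons a l ih =>
    exact tensorHom_tensorHom_comm
      (tensToMap_natural (fun p : (i : ι) × κ i => f p.1 p.2) (Sigma.mk a) (K a)) ih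
      (tensAppend_natural (fun p : (i : ι) × κ i => f p.1 p.2) ((K a).map (Sigma.mk a))
        (l.sigma K))

lemma tensMap_eqToHom {ι : Type} {X Y : ι → M} (f : ∀ i, X i ⟶ Y i) {l l' : List ι}
    (h : l = l') :
    tensMap f l ≫ eqToHom (congrArg (tens Y) h) = eqToHom (congrArg (tens X) h) ≫ tensMap f l' := by
  subst h
  simp

variable [SymmetricCategory M]

lemma tensPull_natural {ι : Type} [DecidableEq ι] {X Y : ι → M} (f : ∀ i, X i ⟶ Y i) (a : ι)
    (l : List ι) (h : a ∈ l) :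
    tensMap f l ≫ tensPull Y a l h = tensPull X a l h ≫ (f a ⊗ₘ tensMap f (l.erase a)) := by
  induction l with
  | nil => exact absurd h List.not_mem_nil
  | cons b l ih =>
    by_cases hb : b = a
    · subst hb
      have e : (b :: l) = b :: (b :: l).erase b := by rw [List.erase_cons_head]
      simp only [tensPull, dif_pos]
      exact tensMap_eqToHom f e
    · have e : b :: l.erase a = (b :: l).erase a := by
        rw [List.erase_cons_tail (by simpa using hb)]
      have h₁ := ih ((List.mem_cons.1 h).resolve_left (Ne.symm hb))
      have h₂ := tensorHom_whiskerLeft_comm (f a) (tensMap_eqToHom f e)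
      have h₃ : ((f b ⊗ₘ f a) ⊗ₘ tensMap f (l.erase a)) ≫
          (β_ (Y b) (Y a)).hom ▷ tens Y (l.erase a) =
          (β_ (X b) (X a)).hom ▷ tens X (l.erase a) ≫
            ((f a ⊗ₘ f b) ⊗ₘ tensMap f (l.erase a)) := by
        rw [← MonoidalCategory.tensorHom_id, ← MonoidalCategory.tensorHom_id,
          MonoidalCategory.tensorHom_comp_tensorHom, MonoidalCategory.tensorHom_comp_tensorHom,
          BraidedCategory.braiding_naturality, Category.comp_id, Category.id_comp]
      simp only [tensPull, dif_neg hb, Category.assoc]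
      rw [tensMap, reassoc_of% tensorHom_whiskerLeft_comm (f b) h₁,
        MonoidalCategory.associator_inv_naturality_assoc, reassoc_of% h₃,
        MonoidalCategory.associator_naturality_assoc]
      exact congrArg (fun t => _ ≫ _ ≫ _ ≫ _ ≫ t) h₂

lemma tensPerm_natural {ι : Type} [DecidableEq ι] {X Y : ι → M} (f : ∀ i, X i ⟶ Y i)
    (l l' : List ι) (h : l.Perm l') :
    tensMap f l ≫ tensPerm Y l l' h = tensPerm X l l' h ≫ tensMap f l' := by
  induction l' generalizing l with
  | nil => exact tensMap_eqToHom f h.eq_nil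
  | cons a l' ih =>
    have h₁ := tensPull_natural f a l (h.mem_iff.2 List.mem_cons_self)
    have h₂ := ih (l.erase a) (List.cons_perm_iff_perm_erase.1 h.symm).2.symm
    simp only [tensPerm, tensMap, Category.assoc]
    rw [reassoc_of% h₁, tensorHom_whiskerLeft_comm _ h₂]

lemma finTensPerm_natural {n : ℕ} (σ : Equiv.Perm (Fin n)) {X Y : Fin n → M}
    (f : ∀ i, X i ⟶ Y i) :
    tensMap f (List.finRange n) ≫ finTensPerm σ Y =
      finTensPerm σ X ≫ tensMap (fun i => f (σ i)) (List.finRange n) := by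
  simp only [finTensPerm, Category.assoc]
  rw [← tensFromMap_natural, ← Category.assoc, tensPerm_natural, Category.assoc]

lemma finTensFlatten_natural {n : ℕ} {k : Fin n → ℕ} {X Y : ∀ i, Fin (k i) → M}
    (f : ∀ i j, X i j ⟶ Y i j) :
    tensMap (fun i => tensMap (f i) (List.finRange (k i))) (List.finRange n) ≫ finTensFlatten Y =
      finTensFlatten X ≫ tensMap (fun a : Fin (∑ i, k i) =>
        f (finSigmaFinEquiv.symm a).1 (finSigmaFinEquiv.symm a).2) (List.finRange _) := by
  have h₁ := tensSigma_natural f (fun i => List.finRange (k i)) (List.finRange n)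
  simp only [finTensFlatten, Category.assoc]
  rw [reassoc_of% h₁, ← tensFromMap_natural (fun p : (i : Fin n) × Fin (k i) => f p.1 p.2),
    ← Category.assoc (tensMap _ _), tensPerm_natural, Category.assoc]

end Naturality

section Operations

variable {M : Type u} [Category.{v} M] [MonoidalCategory M] [SymmetricCategory M]

/-- The functor `X ↦ P(n) ⊗ X^{⊗ n}`. -/
@[reducible]
def opFunctor (P : Operad M) (n : ℕ) : M ⥤ M where
  obj X := P.ob n ⊗ tensPow n X
  map f := P.ob n ◁ tensMap (fun _ => f) (List.finRange n)
  map_id X := by rw [tensMap_id, MonoidalCategory.whiskerLeft_id]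
  map_comp f f' := by rw [tensMap_comp, MonoidalCategory.whiskerLeft_comp]

/-- The functor `opFunctor P n` in terms of tensor product functors. -/
def opFunctorIso (P : Operad M) (n : ℕ) :
    tensFunctor (fun _ => 𝟭 M) (List.finRange n) ⋙ tensorLeft (P.ob n) ≅ opFunctor P n :=
  NatIso.ofComponents (fun _ => Iso.refl _)
    (fun _ => (Category.comp_id _).trans (Category.id_comp _).symm)

instance preservesColimitsOfShape_opFunctor [MonoidalClosed M] (P : Operad M) (n : ℕ)
    {J : Type*} [Category J] [IsSifted J] : PreservesColimitsOfShape J (opFunctor P n) :=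
  preservesColimitsOfShape_of_natIso (opFunctorIso P n)

instance preservesEpimorphisms_opFunctor [MonoidalClosed M] (P : Operad M) (n : ℕ) :
    (opFunctor P n).PreservesEpimorphisms :=
  Functor.PreservesEpimorphisms.of_iso (opFunctorIso P n)

variable {P : Operad M} {X Y : M} {a : ∀ n, (opFunctor P n).obj X ⟶ X}
  {b : ∀ n, (opFunctor P n).obj Y ⟶ Y} {f : X ⟶ Y}

lemma assoc_lhs_natural (hf : ∀ n, a n ≫ f = (opFunctor P n).map f ≫ b n) {n : ℕ}
    (k : Fin n → ℕ) :
    P.ob n ◁ tensMap (fun i => (opFunctor P (k i)).map f) (List.finRange n) ≫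
        P.ob n ◁ tensMap (fun i => b (k i)) (List.finRange n) ≫ b n =
      (P.ob n ◁ tensMap (fun i => a (k i)) (List.finRange n) ≫ a n) ≫ f := by
  rw [Category.assoc, hf, ← MonoidalCategory.whiskerLeft_comp_assoc,
    ← MonoidalCategory.whiskerLeft_comp_assoc, ← tensMap_comp, ← tensMap_comp]
  simp only [hf]

lemma assoc_rhs_natural (hf : ∀ n, a n ≫ f = (opFunctor P n).map f ≫ b n) {n : ℕ}
    (k : Fin n → ℕ) :
    P.ob n ◁ tensMap (fun i => (opFunctor P (k i)).map f) (List.finRange n) ≫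
        P.ob n ◁ finTensZip (fun i => P.ob (k i)) (fun i => tensPow (k i) Y) ≫
        (α_ _ _ _).inv ≫
        (P.comp k ⊗ₘ finTensFlatten (fun (i : Fin n) (_ : Fin (k i)) => Y)) ≫ b (∑ i, k i) =
      (P.ob n ◁ finTensZip (fun i => P.ob (k i)) (fun i => tensPow (k i) X) ≫
        (α_ _ _ _).inv ≫
        (P.comp k ⊗ₘ finTensFlatten (fun (i : Fin n) (_ : Fin (k i)) => X)) ≫
        a (∑ i, k i)) ≫ f := by
  have zip := tensZip_natural (fun i => 𝟙 (P.ob (k i)))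
    (fun i => tensMap (fun _ => f) (List.finRange (k i))) (List.finRange n)
  rw [tensMap_id] at zip
  simp only [MonoidalCategory.id_tensorHom] at zip
  have flatten := finTensFlatten_natural (k := k) (fun _ _ => f)
  simp only [Category.assoc]
  rw [hf, ← MonoidalCategory.whiskerLeft_comp_assoc, zip,
    MonoidalCategory.whiskerLeft_comp_assoc, MonoidalCategory.associator_inv_naturality_right_assoc,
    tensorHom_whiskerLeft_map_comm (P.comp k) flatten]

lemma unit_lhs_natural (hf : ∀ n, a n ≫ f = (opFunctor P n).map f ≫ b n) :
    f ≫ (λ_ Y).inv ≫ (P.unit ⊗ₘ tensOne Y) ≫ b 1 =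
      ((λ_ X).inv ≫ (P.unit ⊗ₘ tensOne X) ≫ a 1) ≫ f := by
  simp only [Category.assoc]
  rw [hf, MonoidalCategory.leftUnitor_inv_naturality_assoc,
    tensorHom_whiskerLeft_map_comm P.unit (tensOne_natural f)]

lemma equivariance_lhs_natural (hf : ∀ n, a n ≫ f = (opFunctor P n).map f ≫ b n) {n : ℕ}
    (σ : Equiv.Perm (Fin n)) :
    (opFunctor P n).map f ≫ (P.perm σ ⊗ₘ finTensPerm σ (fun _ => Y)) ≫ b n =
      ((P.perm σ ⊗ₘ finTensPerm σ (fun _ => X)) ≫ a n) ≫ f := by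
  simp only [Category.assoc]
  rw [hf, tensorHom_whiskerLeft_map_comm (P.perm σ) (finTensPerm_natural σ (fun _ => f))]

lemma binary_natural (hf : ∀ n, a n ≫ f = (opFunctor P n).map f ≫ b n) (r : 𝟙_ M ⟶ P.ob 2)
    {X₁ X₂ Y₁ Y₂ : M} {x₁ : X₁ ⟶ X} {x₂ : X₂ ⟶ X} {y₁ : Y₁ ⟶ Y} {y₂ : Y₂ ⟶ Y} {f₁ : X₁ ⟶ Y₁}
    {f₂ : X₂ ⟶ Y₂} (h₁ : f₁ ≫ y₁ = x₁ ≫ f) (h₂ : f₂ ≫ y₂ = x₂ ≫ f) :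
    𝟙_ M ◁ (f₁ ⊗ₘ f₂) ≫ (r ⊗ₘ ((y₁ ⊗ₘ y₂) ≫ tensTwo Y)) ≫ b 2 =
      ((r ⊗ₘ ((x₁ ⊗ₘ x₂) ≫ tensTwo X)) ≫ a 2) ≫ f := by
  have inputs : (f₁ ⊗ₘ f₂) ≫ (y₁ ⊗ₘ y₂) ≫ tensTwo Y =
      ((x₁ ⊗ₘ x₂) ≫ tensTwo X) ≫ tensMap (fun _ => f) (List.finRange 2) := by
    rw [Category.assoc, ← tensTwo_natural, MonoidalCategory.tensorHom_comp_tensorHom_assoc, h₁, h₂,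
      ← MonoidalCategory.tensorHom_comp_tensorHom_assoc]
  rw [Category.assoc, hf]
  exact tensorHom_whiskerLeft_map_comm r inputs _

end Operations

section ColimitsOfAlgebras

variable {N : Type u} [Category.{v} N] {H : N ⥤ N} {J : Type*} [Category J]
  (K : J ⥤ Endofunctor.Algebra H) {c : Cocone (K ⋙ Endofunctor.Algebra.forget H)}

lemma map_f_str_comp {A B : Endofunctor.Algebra H} (f : A ⟶ B) {X : N} {p : B.a ⟶ X}
    {q : A.a ⟶ X} (h : f.f ≫ p = q) : H.map f.f ≫ B.str ≫ p = A.str ≫ q := by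
  rw [reassoc_of% f.h, h]

lemma map_f_map_str {A B X : Endofunctor.Algebra H} (p : A ⟶ X) (d : X.a ⟶ B.a) (g : A ⟶ B)
    (h : p.f ≫ d = g.f) : H.map p.f ≫ H.map d ≫ B.str = H.map p.f ≫ X.str ≫ d := by
  rw [← H.map_comp_assoc, h, g.h, map_f_str_comp p h]

/-- The cocone with legs `H (K i) ⟶ K i ⟶ c` given by the structure maps of the algebras `K i`. -/
def strCocone (c : Cocone (K ⋙ Endofunctor.Algebra.forget H)) :
    Cocone ((K ⋙ Endofunctor.Algebra.forget H) ⋙ H) where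
  pt := c.pt
  ι :=
    { app i := (K.obj i).str ≫ c.ι.app i
      naturality _ _ f :=
        (map_f_str_comp (K.map f) (c.w f)).trans (Category.comp_id _).symm }

variable [PreservesColimitsOfShape J H]

/-- The colimit, computed on underlying objects, of a diagram of algebras over an endofunctor
that preserves it. -/
noncomputable def algebraCocone (hc : IsColimit c) : Cocone K where
  pt := ⟨c.pt, (isColimitOfPreserves H hc).desc (strCocone K c)⟩
  ι :=
    { app i := ⟨c.ι.app i, (isColimitOfPreserves H hc).fac (strCocone K c) i⟩
      naturality _ _ f := by
        ext
        exact c.ι.naturality f }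

/-- The universal property of `algebraCocone`. -/
noncomputable def isColimitAlgebraCocone (hc : IsColimit c) :
    IsColimit (algebraCocone K hc) where
  desc s :=
    { f := hc.desc ((Endofunctor.Algebra.forget H).mapCocone s)
      h := (isColimitOfPreserves H hc).hom_ext fun i =>
        map_f_map_str ((algebraCocone K hc).ι.app i) _ (s.ι.app i) (hc.fac _ i) }
  fac s i := by
    ext
    exact hc.fac ((Endofunctor.Algebra.forget H).mapCocone s) i
  uniq s m hm := by
    ext
    exact hc.uniq ((Endofunctor.Algebra.forget H).mapCocone s) m.f
      fun i => congrArg Endofunctor.Algebra.Hom.f (hm i)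

variable [HasColimitsOfShape J N]

instance hasColimitsOfShape_algebra : HasColimitsOfShape J (Endofunctor.Algebra H) where
  has_colimit K := ⟨⟨_, isColimitAlgebraCocone K (colimit.isColimit _)⟩⟩

instance preservesColimitsOfShape_algebraForget :
    PreservesColimitsOfShape J (Endofunctor.Algebra.forget H) where
  preservesColimit {K} := preservesColimit_of_preserves_colimit_cocone
    (isColimitAlgebraCocone K (colimit.isColimit _))
    ((colimit.isColimit (K ⋙ Endofunctor.Algebra.forget H)).ofIsoColimit
      (Cocone.ext (Iso.refl _) fun _ => Category.comp_id _))

end ColimitsOfAlgebras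

section InitialAlgebra

variable {N : Type u} [Category.{v} N] (H : N ⥤ N) [HasInitial N]

/-- The iterates `⊥, H ⊥, H (H ⊥), …`. -/
@[reducible]
noncomputable def chainObj : ℕ → N
  | 0 => ⊥_ N
  | n + 1 => H.obj (chainObj n)

/-- The iterates under `H` of the unique morphism `⊥ ⟶ H ⊥`. -/
noncomputable def chainMap : ∀ n, chainObj H n ⟶ chainObj H (n + 1)
  | 0 => initial.to _
  | n + 1 => H.map (chainMap n)

/-- The chain `⊥ ⟶ H ⊥ ⟶ H (H ⊥) ⟶ ⋯` whose colimit is the initial `H`-algebra (Adámek). -/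
noncomputable abbrev initialChain : ℕ ⥤ N := Functor.ofSequence (chainMap H)

variable {H}

/-- The legs of a cocone over the initial chain, shifted by one step. -/
noncomputable def shiftCocone (c : Cocone (initialChain H)) : Cocone (initialChain H ⋙ H) where
  pt := c.pt
  ι := NatTrans.ofSequence (fun n => c.ι.app (n + 1)) fun n => by
    have h := c.w (homOfLE (Nat.le_succ (n + 1)))
    rw [Functor.ofSequence_map_homOfLE_succ] at h
    rw [Functor.comp_map, Functor.ofSequence_map_homOfLE_succ]
    exact h.trans (Category.comp_id _).symm

/-- The iterated structure maps `Hⁿ ⊥ ⟶ A` of an algebra. -/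
noncomputable def chainToAlgebra (A : Endofunctor.Algebra H) : ∀ n, chainObj H n ⟶ A.a
  | 0 => initial.to _
  | n + 1 => H.map (chainToAlgebra A n) ≫ A.str

lemma chainMap_chainToAlgebra (A : Endofunctor.Algebra H) (n : ℕ) :
    chainMap H n ≫ chainToAlgebra A (n + 1) = chainToAlgebra A n := by
  induction n with
  | zero => exact initial.hom_ext _ _
  | succ n ih =>
    have h : H.map (chainMap H n) ≫ H.map (chainToAlgebra A (n + 1)) ≫ A.str =
        H.map (chainToAlgebra A n) ≫ A.str := by rw [← H.map_comp_assoc, ih]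
    exact h

/-- The cocone over the initial chain given by an algebra. -/
noncomputable def chainCocone (A : Endofunctor.Algebra H) : Cocone (initialChain H) where
  pt := A.a
  ι := NatTrans.ofSequence (chainToAlgebra A) fun n => by
    rw [Functor.ofSequence_map_homOfLE_succ]
    exact (chainMap_chainToAlgebra A n).trans (Category.comp_id _).symm

variable (H) [HasColimitsOfShape ℕ N] [PreservesColimitsOfShape ℕ H]

/-- The algebra on the colimit of the initial chain. -/
noncomputable def chainColimit : Endofunctor.Algebra H where
  a := colimit (initialChain H)
  str := (isColimitOfPreserves H (colimit.isColimit (initialChain H))).desc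
    (shiftCocone (colimit.cocone _))

/-- The leg at `n` of the colimit cocone. -/
noncomputable def chainι (n : ℕ) : chainObj H n ⟶ (chainColimit H).a :=
  colimit.ι (initialChain H) n

lemma map_chainι_str (n : ℕ) :
    H.map (chainι H n) ≫ (chainColimit H).str = chainι H (n + 1) :=
  (isColimitOfPreserves H (colimit.isColimit (initialChain H))).fac
    (shiftCocone (colimit.cocone _)) n

variable {H} in
lemma chainColimit_hom_ext {X : N} {f g : (chainColimit H).a ⟶ X}
    (h : ∀ n, chainι H n ≫ f = chainι H n ≫ g) : f = g :=
  colimit.hom_ext h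

variable {H} in
lemma obj_chainColimit_hom_ext {X : N} {f g : H.obj (chainColimit H).a ⟶ X}
    (h : ∀ n, H.map (chainι H n) ≫ f = H.map (chainι H n) ≫ g) : f = g :=
  (isColimitOfPreserves H (colimit.isColimit (initialChain H))).hom_ext h

instance hasInitial_algebra : HasInitial (Endofunctor.Algebra H) := by
  let d (A : Endofunctor.Algebra H) : (chainColimit H).a ⟶ A.a :=
    colimit.desc (initialChain H) (chainCocone A)
  have ι_desc (A : Endofunctor.Algebra H) (n : ℕ) : chainι H n ≫ d A = chainToAlgebra A n :=
    colimit.ι_desc _ _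
  refine IsInitial.hasInitial (X := chainColimit H) (IsInitial.ofUniqueHom
    (fun A => ⟨d A, obj_chainColimit_hom_ext fun n => ?_⟩)
    fun A m => Endofunctor.Algebra.Hom.ext (chainColimit_hom_ext fun n => ?_))
  · rw [← H.map_comp_assoc, reassoc_of% map_chainι_str, ι_desc, ι_desc, chainToAlgebra]
  · rw [ι_desc]
    induction n with
    | zero => exact initial.hom_ext _ _
    | succ n ih =>
      rw [← map_chainι_str, Category.assoc, ← m.h, ← H.map_comp_assoc, ih, chainToAlgebra]

end InitialAlgebra

section FreeAlgebra

variable {N : Type u} [Category.{v} N] {J : Type*} [Category J]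

instance preservesColimitsOfShape_coprodFunctor [HasBinaryCoproducts N] [IsConnected J] (X : N) :
    PreservesColimitsOfShape J (coprod.functor.obj X) := by
  have : PreservesColimitsOfShape J (Under.forget X) :=
    inferInstanceAs (PreservesColimitsOfShape J (StructuredArrow.proj X (𝟭 N)))
  exact preservesColimitsOfShape_of_natIso
    (show Under.costar X ⋙ Under.forget X ≅ coprod.functor.obj X from Iso.refl _)

instance preservesColimitsOfShape_colimit {K N' : Type*} [Category K] [Category N']
    (G : K ⥤ N ⥤ N') [∀ k, PreservesColimitsOfShape J (G.obj k)] [HasColimitsOfShape K N'] :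
    PreservesColimitsOfShape J (colimit G) := by
  have : PreservesColimitsOfShape J G.flip :=
    preservesColimitsOfShape_of_evaluation _ _ fun k =>
      inferInstanceAs (PreservesColimitsOfShape J (G.obj k))
  exact preservesColimitsOfShape_of_natIso (colimitIsoFlipCompColim G).symm

lemma coprod_map_comp_eq_iff [HasBinaryCoproducts N] {X A B A' B' : N} (h : A ⟶ B)
    (s : X ⨿ A ⟶ A') (t : X ⨿ B ⟶ B') (p : A' ⟶ B') :
    coprod.map (𝟙 X) h ≫ t = s ≫ p ↔
      (coprod.inl ≫ s) ≫ p = coprod.inl ≫ t ∧ h ≫ coprod.inr ≫ t = (coprod.inr ≫ s) ≫ p := by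
  constructor
  · intro e
    simp [← e]
  · rintro ⟨e₁, e₂⟩
    ext
    · simpa using e₁.symm
    · simpa using e₂

variable [HasBinaryCoproducts N] {H : N ⥤ N} {X : N}

/-- The structure map of an algebra over `X ⨿ H (-)`. -/
def coprodStr (B : Endofunctor.Algebra (H ⋙ coprod.functor.obj X)) : X ⨿ H.obj B.a ⟶ B.a := B.str

/-- The `H`-algebra underlying an algebra over `X ⨿ H (-)`. -/
noncomputable def algebraOfCoprod (B : Endofunctor.Algebra (H ⋙ coprod.functor.obj X)) :
    Endofunctor.Algebra H where
  a := B.a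
  str := coprod.inr ≫ coprodStr B

variable (H X) in
/-- The algebras over `X ⨿ H (-)` regarded as `H`-algebras `A` with a morphism from `X` to the
object underlying `A`. -/
noncomputable def pointedAlgebra :
    Endofunctor.Algebra (H ⋙ coprod.functor.obj X) ⥤
      StructuredArrow X (Endofunctor.Algebra.forget H) where
  obj B := StructuredArrow.mk (T := Endofunctor.Algebra.forget H) (Y := algebraOfCoprod B)
    (show X ⟶ B.a from coprod.inl ≫ coprodStr B)
  map {B B'} f :=
    have hf := (coprod_map_comp_eq_iff (H.map f.f) (coprodStr B) (coprodStr B') f.f).1 f.h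
    StructuredArrow.homMk ⟨f.f, hf.2⟩ hf.1

instance isEquivalence_pointedAlgebra : (pointedAlgebra H X).IsEquivalence where
  faithful := ⟨fun h => Endofunctor.Algebra.Hom.ext
    (congrArg (fun g => Endofunctor.Algebra.Hom.f (StructuredArrow.Hom.right g)) h)⟩
  full := ⟨fun {B B'} m => ⟨⟨m.right.f,
    (coprod_map_comp_eq_iff (H.map m.right.f) (coprodStr B) (coprodStr B') m.right.f).2
      ⟨StructuredArrow.w m, m.right.h⟩⟩, rfl⟩⟩
  essSurj := ⟨fun x => by
    let B : Endofunctor.Algebra (H ⋙ coprod.functor.obj X) :=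
      ⟨x.right.a, coprod.desc x.hom x.right.str⟩
    have inl_str : coprod.inl ≫ coprodStr B = x.hom := coprod.inl_desc _ _
    have inr_str : coprod.inr ≫ coprodStr B = x.right.str := coprod.inr_desc _ _
    have h : H.map (𝟙 x.right.a) ≫ x.right.str = (coprod.inr ≫ coprodStr B) ≫ 𝟙 x.right.a := by
      rw [inr_str, H.map_id, Category.id_comp, Category.comp_id]
    exact ⟨B, ⟨StructuredArrow.isoMk (Endofunctor.Algebra.isoMk (Iso.refl _) h)
      ((Category.comp_id _).trans inl_str)⟩⟩⟩

/-- The free algebra on `X` is the initial algebra over `X ⨿ H (-)`. -/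
instance isRightAdjoint_algebraForget [HasInitial N] [HasColimitsOfShape ℕ N]
    [PreservesColimitsOfShape ℕ H] :
    (Endofunctor.Algebra.forget H).IsRightAdjoint :=
  isRightAdjoint_iff_hasInitial_structuredArrow.2 fun X =>
    (initialIsInitial.isInitialObj (pointedAlgebra H X)).hasInitial

end FreeAlgebra

section ReflexiveCoequalizers

open WalkingParallelPair in
instance preservesColimitOfIsReflexivePair {T N : Type*} [Category.{v} T] [Category.{v} N]
    (U : T ⥤ N) [PreservesColimitsOfShape WalkingReflexivePair U] :
    Monad.PreservesColimitOfIsReflexivePair U where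
  out _ _ f g _ :=
    have := Functor.Final.comp_preservesColimit inclusionWalkingReflexivePair
      (G := ofIsReflexivePair f g) (H := U)
    preservesColimit_of_iso_diagram U (inclusionWalkingReflexivePairOfIsReflexivePairIso f g)

instance hasReflexiveCoequalizers {T : Type*} [Category T]
    [HasColimitsOfShape WalkingReflexivePair T] : HasReflexiveCoequalizers T :=
  hasReflexiveCoequalizers_iff.1 inferInstance

lemma epi_map_coequalizer_π {T N : Type*} [Category.{v} T] [Category.{v} N] (U : T ⥤ N)
    [HasColimitsOfShape WalkingReflexivePair T] [PreservesColimitsOfShape WalkingReflexivePair U]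
    {A B : T} (f g : A ⟶ B) [IsReflexivePair f g] : Epi (U.map (coequalizer.π f g)) :=
  have := Monad.PreservesColimitOfIsReflexivePair.out (G := U) f g
  epi_of_isColimit_cofork (isColimitOfHasCoequalizerOfPreservesColimit U f g)

end ReflexiveCoequalizers

section Equations

open WalkingReflexivePair

variable {T N : Type*} [Category.{v} T] [Category.{v} N]

/-- A system of equations between operations on the objects `U.obj A`, with inputs in
`arity.obj (U.obj A)` and outputs in `value.obj (U.obj A)`. -/
structure Equation (U : T ⥤ N) (K : Type*) [Category K] where
  arity : N ⥤ K
  value : N ⥤ K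
  lhs : U ⋙ arity ⟶ U ⋙ value
  rhs : U ⋙ arity ⟶ U ⋙ value
  preservesEpimorphisms_arity : arity.PreservesEpimorphisms
  isRightAdjoint_value : value.IsRightAdjoint

attribute [instance] Equation.preservesEpimorphisms_arity Equation.isRightAdjoint_value

variable {U : T ⥤ N} {K : Type*} [Category K] {I : Type*} (E : I → Equation U K)

/-- The objects satisfying a family of equations. -/
def models : ObjectProperty T := fun A => ∀ i, (E i).lhs.app A = (E i).rhs.app A

variable {E}

lemma lhs_comp_map_eq_iff (e : Equation U K) {A B : T} (q : A ⟶ B) [Epi (U.map q)] :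
    e.lhs.app A ≫ e.value.map (U.map q) = e.rhs.app A ≫ e.value.map (U.map q) ↔
      e.lhs.app B = e.rhs.app B := by
  rw [← cancel_epi (e.arity.map (U.map q))]
  exact (Eq.congr (e.lhs.naturality q) (e.rhs.naturality q)).symm

lemma models_of_epi {A B : T} (q : A ⟶ B) [Epi (U.map q)] (hA : models E A) : models E B :=
  fun i => (lhs_comp_map_eq_iff (E i) q).1 (by rw [hA i])

lemma epi_ι_app_zero {F : WalkingReflexivePair ⥤ N} {c : Cocone F} (hc : IsColimit c) :
    Epi (c.ι.app zero) where
  left_cancellation _ _ h := hc.hom_ext fun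
    | zero => h
    | one => by rw [← c.w WalkingReflexivePair.Hom.left, Category.assoc, h, Category.assoc]

instance isClosedUnderColimitsOfShape_models [PreservesColimitsOfShape WalkingReflexivePair U] :
    (models E).IsClosedUnderColimitsOfShape WalkingReflexivePair where
  colimitsOfShape_le _ := fun ⟨h⟩ =>
    have : Epi (U.map (h.ι.app zero)) := epi_ι_app_zero (isColimitOfPreserves U h.isColimit)
    models_of_epi (h.ι.app zero) (h.prop_diag_obj zero)

section Relations

variable {F : N ⥤ T} (adj : F ⊣ U) [HasBinaryCoproducts N]

/-- The morphism which extends `s : R ⟶ U.obj (F.obj G)` by the identity on the generators `G`.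
Thus a pair of morphisms imposing relations on `F.obj G` becomes a reflexive pair. -/
noncomputable def reflexiveExtension {G R : N} (s : R ⟶ U.obj (F.obj G)) :
    F.obj (G ⨿ R) ⟶ F.obj G :=
  (adj.homEquiv _ _).symm (coprod.desc (adj.homEquiv _ _ (𝟙 _)) s)

instance isReflexivePair_reflexiveExtension {G R : N} (s t : R ⟶ U.obj (F.obj G)) :
    IsReflexivePair (reflexiveExtension adj s) (reflexiveExtension adj t) := by
  have section_comp (s : R ⟶ U.obj (F.obj G)) :
      F.map coprod.inl ≫ reflexiveExtension adj s = 𝟙 _ := by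
    rw [reflexiveExtension, ← Adjunction.homEquiv_naturality_left_symm, coprod.inl_desc,
      Equiv.symm_apply_apply]
  exact .mk' (F.map coprod.inl) (section_comp s) (section_comp t)

lemma reflexiveExtension_comp_eq_iff {G R : N} (s t : R ⟶ U.obj (F.obj G)) {B : T}
    (q : F.obj G ⟶ B) :
    reflexiveExtension adj s ≫ q = reflexiveExtension adj t ≫ q ↔
      s ≫ U.map q = t ≫ U.map q := by
  rw [reflexiveExtension, reflexiveExtension, ← Adjunction.homEquiv_naturality_right_symm,
    ← Adjunction.homEquiv_naturality_right_symm, EmbeddingLike.apply_eq_iff_eq,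
    coprod.hom_ext_iff]
  simp only [coprod.inl_desc_assoc, coprod.inr_desc_assoc, true_and]

end Relations

section UniversalModel

variable [HasColimitsOfShape (Discrete I) N]

variable (E) in
/-- The object indexing the relations which the equations impose on `A`. -/
@[reducible]
noncomputable def relations (A : T) : N :=
  ∐ fun i => (E i).value.leftAdjoint.obj ((E i).arity.obj (U.obj A))

/-- The relations on `A` given by one of the two sides of each equation. -/
noncomputable def relationSide {A : T}
    (t : ∀ i, (E i).arity.obj (U.obj A) ⟶ (E i).value.obj (U.obj A)) :
    relations E A ⟶ U.obj A :=
  Sigma.desc fun i => ((Adjunction.ofIsRightAdjoint (E i).value).homEquiv _ _).symm (t i)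

lemma relationSide_comp_eq_iff {A B : T}
    (s t : ∀ i, (E i).arity.obj (U.obj A) ⟶ (E i).value.obj (U.obj A)) (q : A ⟶ B) :
    relationSide s ≫ U.map q = relationSide t ≫ U.map q ↔
      ∀ i, s i ≫ (E i).value.map (U.map q) = t i ≫ (E i).value.map (U.map q) := by
  rw [relationSide, relationSide, Sigma.hom_ext_iff]
  refine forall_congr' fun i => ?_
  rw [Sigma.ι_desc_assoc, Sigma.ι_desc_assoc, ← Adjunction.homEquiv_naturality_right_symm,
    ← Adjunction.homEquiv_naturality_right_symm, EmbeddingLike.apply_eq_iff_eq]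

variable [HasBinaryCoproducts N] [HasColimitsOfShape WalkingReflexivePair T]
  {F : N ⥤ T} (adj : F ⊣ U)

variable (E) in
/-- The quotient of the free object `F.obj G` by the relations which the equations impose. -/
noncomputable def quotient (G : N) : T :=
  coequalizer
    (reflexiveExtension adj (relationSide (E := E) fun i => (E i).lhs.app (F.obj G)))
    (reflexiveExtension adj (relationSide (E := E) fun i => (E i).rhs.app (F.obj G)))

variable (E) in
/-- The projection of the free object onto its quotient by the relations. -/
noncomputable def quotientMap (G : N) : F.obj G ⟶ quotient E adj G :=
  coequalizer.π _ _

lemma quotientMap_condition (G : N) (i : I) :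
    (E i).lhs.app (F.obj G) ≫ (E i).value.map (U.map (quotientMap E adj G)) =
      (E i).rhs.app (F.obj G) ≫ (E i).value.map (U.map (quotientMap E adj G)) :=
  (relationSide_comp_eq_iff (fun i => (E i).lhs.app _) (fun i => (E i).rhs.app _) _).1
    ((reflexiveExtension_comp_eq_iff adj _ _ _).1 (coequalizer.condition _ _)) i

lemma existsUnique_quotientMap_comp {G : N} {B : T} (hB : models E B) (q : F.obj G ⟶ B) :
    ∃! h, quotientMap E adj G ≫ h = q := by
  have hq (i) : (E i).lhs.app _ ≫ (E i).value.map (U.map q) =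
      (E i).rhs.app _ ≫ (E i).value.map (U.map q) :=
    ((E i).lhs.naturality q).symm.trans
      ((congrArg _ (hB i)).trans ((E i).rhs.naturality q))
  have condition := (reflexiveExtension_comp_eq_iff adj _ _ q).2
    ((relationSide_comp_eq_iff (fun i => (E i).lhs.app _) (fun i => (E i).rhs.app _) q).2 hq)
  exact ⟨coequalizer.desc q condition, coequalizer.π_desc q condition,
    fun h hh => coequalizer.hom_ext (hh.trans (coequalizer.π_desc q condition).symm)⟩

variable [PreservesColimitsOfShape WalkingReflexivePair U]

instance epi_map_quotientMap (G : N) : Epi (U.map (quotientMap E adj G)) :=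
  epi_map_coequalizer_π U _ _

variable (E) in
/-- The universal model of the equations generated by `G`. -/
@[reducible]
noncomputable def universalModel (G : N) : (models E).FullSubcategory where
  obj := quotient E adj G
  property i := (lhs_comp_map_eq_iff (E i) (quotientMap E adj G)).1 (quotientMap_condition adj G i)

/-- The universal property of the universal model. -/
noncomputable def universalModelHomEquiv (G : N) (B : (models E).FullSubcategory) :
    (universalModel E adj G ⟶ B) ≃ (G ⟶ U.obj B.obj) :=
  (Equiv.ofBijective (fun h : universalModel E adj G ⟶ B => quotientMap E adj G ≫ h.hom)
    ((Function.bijective_iff_existsUnique _).2 fun q => by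
      obtain ⟨h, hh, unique⟩ := existsUnique_quotientMap_comp adj B.property q
      exact ⟨ObjectProperty.homMk h, hh, fun h' hh' =>
        ObjectProperty.hom_ext _ (unique h'.hom hh')⟩)).trans (adj.homEquiv G B.obj)

/-- The adjunction between universal models and the underlying objects of models. -/
noncomputable def universalModelAdjunction :
    Adjunction.leftAdjointOfEquiv (G := (models E).ι ⋙ U) (F_obj := universalModel E adj)
      (universalModelHomEquiv adj) (fun _ _ _ f _ =>
        (congrArg _ (Category.assoc _ _ _).symm).trans (adj.homEquiv_naturality_right _ f.hom)) ⊣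
      (models E).ι ⋙ U :=
  Adjunction.adjunctionOfEquivLeft _ _

lemma homEquiv_universalModelAdjunction {G : N} {B : (models E).FullSubcategory}
    (h : universalModel E adj G ⟶ B) :
    (universalModelAdjunction adj).homEquiv G B h =
      adj.homEquiv G B.obj (quotientMap E adj G ≫ h.hom) :=
  DFunLike.congr_fun (congrFun₂ (Adjunction.mkOfHomEquiv_homEquiv _) G B) h

variable (E) in
lemma isRightAdjoint_models_ι_comp {F : N ⥤ T} (adj : F ⊣ U) : ((models E).ι ⋙ U).IsRightAdjoint :=
  (universalModelAdjunction (E := E) adj).isRightAdjoint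

lemma epi_map_homEquiv_symm_unit {F' : N ⥤ (models E).FullSubcategory}
    (adj' : F' ⊣ (models E).ι ⋙ U) (G : N) :
    Epi (U.map ((adj.homEquiv G (F'.obj G).obj).symm (adj'.unit.app G))) := by
  let i : universalModel E adj G ≅ F'.obj G :=
    (Adjunction.leftAdjointUniq (universalModelAdjunction adj) adj').app G
  have hi : adj.homEquiv _ _ (quotientMap E adj G ≫ i.hom.hom) = adj'.unit.app G :=
    (homEquiv_universalModelAdjunction adj i.hom).symm.trans
      (Adjunction.homEquiv_leftAdjointUniq_hom_app (universalModelAdjunction adj) adj' G)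
  have : Epi (U.map (i.hom.hom)) :=
    inferInstanceAs (Epi (((models E).ι ⋙ U).map i.hom))
  rw [← hi, Equiv.symm_apply_apply, U.map_comp]
  exact epi_comp _ _

end UniversalModel

end Equations

section OperadAlgebras

variable {M : Type u} [Category.{v} M] [MonoidalCategory M] [SymmetricCategory M]

/-- The functor which sends an algebra to its underlying object. -/
def Alg.forget (P : Operad M) : Alg P ⥤ M where
  obj A := A.carrier
  map f := f.hom

instance faithful_algForget (P : Operad M) : (Alg.forget P).Faithful where
  map_injective := Alg.hom_ext _ _

instance reflectsIsomorphisms_algForget (P : Operad M) : (Alg.forget P).ReflectsIsomorphisms where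
  reflects {A B} f hf := by
    obtain ⟨g, hom_inv, inv_hom⟩ : ∃ g : B.carrier ⟶ A.carrier,
        f.hom ≫ g = 𝟙 _ ∧ g ≫ f.hom = 𝟙 _ :=
      hf.out
    have act_inv (n : ℕ) : B.act n ≫ g = (opFunctor P n).map g ≫ A.act n := by
      have cancel : (opFunctor P n).map g ≫ (opFunctor P n).map f.hom = 𝟙 _ := by
        rw [← CategoryTheory.Functor.map_comp, inv_hom, CategoryTheory.Functor.map_id]
      rw [← Category.comp_id (A.act n), ← hom_inv, reassoc_of% f.act_hom n, reassoc_of% cancel]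
    exact ⟨⟨g, act_inv⟩, Alg.hom_ext _ _ hom_inv, Alg.hom_ext _ _ inv_hom⟩

variable [HasColimits M]

/-- The functor `X ↦ ∐ₙ P(n) ⊗ X^{⊗ n}`. Its algebras are the objects on which the operations of
`P` act, subject to no equations. -/
noncomputable def operations (P : Operad M) : M ⥤ M := ∐ opFunctor P

instance preservesColimitsOfShape_operations [MonoidalClosed M] (P : Operad M) {J : Type*}
    [Category J] [IsSifted J] : PreservesColimitsOfShape J (operations P) :=
  have (n : Discrete ℕ) : PreservesColimitsOfShape J ((Discrete.functor (opFunctor P)).obj n) :=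
    preservesColimitsOfShape_opFunctor P n.as
  preservesColimitsOfShape_colimit _

/-- The inclusion of the `n`-ary operations of `P` into `operations P`. -/
noncomputable def operationsι (P : Operad M) (n : ℕ) (X : M) :
    (opFunctor P n).obj X ⟶ (operations P).obj X :=
  (Sigma.ι (opFunctor P) n).app X

lemma operationsι_naturality (P : Operad M) (n : ℕ) {X Y : M} (f : X ⟶ Y) :
    operationsι P n X ≫ (operations P).map f = (opFunctor P n).map f ≫ operationsι P n Y :=
  ((Sigma.ι (opFunctor P) n).naturality f).symm

lemma existsUnique_operationsι_comp (P : Operad M) {X Y : M}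
    (a : ∀ n, (opFunctor P n).obj X ⟶ Y) :
    ∃! s : (operations P).obj X ⟶ Y, ∀ n, operationsι P n X ≫ s = a n := by
  let hc := isColimitOfHasCoproductOfPreservesColimit ((evaluation M M).obj X) (opFunctor P)
  exact ⟨Cofan.IsColimit.desc hc a, fun n => Cofan.IsColimit.fac hc a n,
    fun s hs => Cofan.IsColimit.hom_ext hc _ _ fun n =>
      (hs n).trans (Cofan.IsColimit.fac hc a n).symm⟩

lemma operations_hom_ext (P : Operad M) {X Y : M} {s t : (operations P).obj X ⟶ Y}
    (h : ∀ n, operationsι P n X ≫ s = operationsι P n X ≫ t) : s = t :=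
  (existsUnique_operationsι_comp P (fun n => operationsι P n X ≫ t)).unique h (fun _ => rfl)

variable (P : Operad M)

/-- The action of the `n`-ary operations of `P` on an algebra over `operations P`. -/
noncomputable def action (A : Endofunctor.Algebra (operations P)) (n : ℕ) :
    (opFunctor P n).obj A.a ⟶ A.a :=
  operationsι P n A.a ≫ A.str

variable {P}

lemma action_comp_eq_iff {A B : Endofunctor.Algebra (operations P)} (f : A.a ⟶ B.a) :
    (∀ n, action P A n ≫ f = (opFunctor P n).map f ≫ action P B n) ↔
      (operations P).map f ≫ B.str = A.str ≫ f := by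
  have side (n : ℕ) : operationsι P n A.a ≫ (operations P).map f ≫ B.str =
      (opFunctor P n).map f ≫ action P B n := by
    rw [reassoc_of% operationsι_naturality P n f]; rfl
  refine ⟨fun h => operations_hom_ext P fun n => ?_, fun h n => ?_⟩
  · rw [side, ← h, action, Category.assoc]
  · rw [← side, h, action, Category.assoc]

lemma action_comp_hom {A B : Endofunctor.Algebra (operations P)} (f : A ⟶ B) (n : ℕ) :
    action P A n ≫ f.f = (opFunctor P n).map f.f ≫ action P B n :=
  (action_comp_eq_iff f.f).2 f.h n

/-- The axioms of an algebra over an operad. -/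
inductive AlgAxiom
  | assoc {n : ℕ} (k : Fin n → ℕ)
  | unit
  | equivariance {n : ℕ} (σ : Equiv.Perm (Fin n))

/-- The associativity axiom of an algebra over `P`, with the arities `k` of the inner operations. -/
noncomputable def assocEquation [MonoidalClosed M] (P : Operad M) {n : ℕ} (k : Fin n → ℕ) :
    Equation (Endofunctor.Algebra.forget (operations P)) M where
  arity := tensFunctor (fun i => opFunctor P (k i)) (List.finRange n) ⋙ tensorLeft (P.ob n)
  value := 𝟭 M
  lhs :=
    { app A := P.ob n ◁ tensMap (fun i => action P A (k i)) (List.finRange n) ≫ action P A n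
      naturality _ _ f := assoc_lhs_natural (action_comp_hom f) k }
  rhs :=
    { app A := P.ob n ◁ finTensZip (fun i => P.ob (k i)) (fun i => tensPow (k i) A.a) ≫
        (α_ _ _ _).inv ≫
        (P.comp k ⊗ₘ finTensFlatten (fun (i : Fin n) (_ : Fin (k i)) => A.a)) ≫
        action P A (∑ i, k i)
      naturality _ _ f := assoc_rhs_natural (action_comp_hom f) k }
  preservesEpimorphisms_arity := inferInstance
  isRightAdjoint_value := inferInstance

/-- The unit axiom of an algebra over `P`. -/
noncomputable def unitEquation (P : Operad M) :
    Equation (Endofunctor.Algebra.forget (operations P)) M where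
  arity := 𝟭 M
  value := 𝟭 M
  lhs :=
    { app A := (λ_ A.a).inv ≫ (P.unit ⊗ₘ tensOne A.a) ≫ action P A 1
      naturality _ _ f := unit_lhs_natural (action_comp_hom f) }
  rhs :=
    { app A := 𝟙 A.a
      naturality _ _ f := (Category.comp_id f.f).trans (Category.id_comp f.f).symm }
  preservesEpimorphisms_arity := inferInstance
  isRightAdjoint_value := inferInstance

/-- The equivariance axiom of an algebra over `P` for the permutation `σ`. -/
noncomputable def equivarianceEquation [MonoidalClosed M] (P : Operad M) {n : ℕ}
    (σ : Equiv.Perm (Fin n)) : Equation (Endofunctor.Algebra.forget (operations P)) M where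
  arity := opFunctor P n
  value := 𝟭 M
  lhs :=
    { app A := (P.perm σ ⊗ₘ finTensPerm σ (fun _ => A.a)) ≫ action P A n
      naturality _ _ f := equivariance_lhs_natural (action_comp_hom f) σ }
  rhs :=
    { app A := action P A n
      naturality _ _ f := (action_comp_hom f n).symm }
  preservesEpimorphisms_arity := inferInstance
  isRightAdjoint_value := inferInstance

/-- The equation between actions of operations expressed by an axiom. -/
noncomputable def algEquation [MonoidalClosed M] (P : Operad M) :
    AlgAxiom → Equation (Endofunctor.Algebra.forget (operations P)) M
  | .assoc k => assocEquation P k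
  | .unit => unitEquation P
  | .equivariance σ => equivarianceEquation P σ

variable [MonoidalClosed M] (P : Operad M)

/-- The algebras over `operations P` which satisfy the axioms, regarded as algebras over the
operad `P`. -/
noncomputable def modelsToAlg : (models (algEquation P)).FullSubcategory ⥤ Alg P where
  obj A :=
    { carrier := A.obj.a
      act := action P A.obj
      assoc k := A.property (.assoc k)
      unit := A.property .unit
      equivariance σ := A.property (.equivariance σ) }
  map f := ⟨f.hom.f, action_comp_hom f.hom⟩

instance faithful_modelsToAlg : (modelsToAlg P).Faithful where
  map_injective h := ObjectProperty.hom_ext _ (Endofunctor.Algebra.Hom.ext (congrArg Alg.Hom.hom h))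

instance full_modelsToAlg : (modelsToAlg P).Full where
  map_surjective f := ⟨ObjectProperty.homMk ⟨f.hom, (action_comp_eq_iff f.hom).1 f.act_hom⟩, rfl⟩

instance essSurj_modelsToAlg : (modelsToAlg P).EssSurj where
  mem_essImage := by
    rintro ⟨X, a, assoc, unit, equivariance⟩
    obtain ⟨s, hs, -⟩ := existsUnique_operationsι_comp P a
    obtain rfl : action P ⟨X, s⟩ = a := funext hs
    exact ⟨⟨⟨X, s⟩, fun
      | .assoc k => assoc k
      | .unit => unit
      | .equivariance σ => equivariance σ⟩, ⟨Iso.refl _⟩⟩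

instance isEquivalence_modelsToAlg : (modelsToAlg P).IsEquivalence where

/-- The underlying object of an algebra, through the presentation of algebras by equations. -/
noncomputable def modelsForgetIso :
    (modelsToAlg P).inv ⋙ (models (algEquation P)).ι ⋙ Endofunctor.Algebra.forget (operations P) ≅
      Alg.forget P :=
  Functor.isoWhiskerRight (modelsToAlg P).asEquivalence.counitIso (Alg.forget P)

instance isRightAdjoint_algForget : (Alg.forget P).IsRightAdjoint :=
  have := isRightAdjoint_models_ι_comp (algEquation P)
    (Adjunction.ofIsRightAdjoint (Endofunctor.Algebra.forget (operations P)))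
  Functor.isRightAdjoint_of_iso (modelsForgetIso P)

instance hasColimitsOfShape_alg : HasColimitsOfShape WalkingReflexivePair (Alg P) :=
  Adjunction.hasColimitsOfShape_of_equivalence (modelsToAlg P).inv

instance preservesColimitsOfShape_algForget :
    PreservesColimitsOfShape WalkingReflexivePair (Alg.forget P) :=
  preservesColimitsOfShape_of_natIso (modelsForgetIso P)

end OperadAlgebras

section FieldTheories

variable {M : Type u} [Category.{v} M] [MonoidalCategory M] [SymmetricCategory M]
  {C : Type v} [SmallCategory C]

/-- A pair of orthogonal morphisms of an orthogonal category. -/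
structure Orthogonality.Pair (oC : Orthogonality C) where
  {c₁ c₂ c : C}
  f₁ : c₁ ⟶ c
  f₂ : c₂ ⟶ c
  rel : oC.rel f₁ f₂

/-- The functor which sends a diagram of algebras to its underlying diagram of objects. -/
abbrev diagramForget (C : Type v) [SmallCategory C] (P : Operad M) : (C ⥤ Alg P) ⥤ C ⥤ M :=
  (Functor.whiskeringRight C _ _).obj (Alg.forget P)

lemma epi_whiskerLeft_of_epi_diagramForget_map [HasColimits M] {D : Type v}
    [SmallCategory D] (j : C ⥤ D) {P : Operad M} {𝔄 𝔅 : D ⥤ Alg P} (q : 𝔄 ⟶ 𝔅)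
    [Epi ((diagramForget D P).map q)] : Epi (Functor.whiskerLeft j q) :=
  have (c : C) : Epi ((Functor.whiskerLeft j q).app c) :=
    (Alg.forget P).epi_of_epi_map
      (inferInstanceAs (Epi (((diagramForget D P).map q).app (j.obj c))))
  NatTrans.epi_of_epi_app _

/-- The inputs `𝟙_ ⊗ (X c₁ ⊗ X c₂)` of the field theory condition for a pair of orthogonal
morphisms. -/
@[reducible]
def Orthogonality.Pair.inputs {oC : Orthogonality C} (p : oC.Pair) : (C ⥤ M) ⥤ M where
  obj X := 𝟙_ M ⊗ (X.obj p.c₁ ⊗ X.obj p.c₂)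
  map f := 𝟙_ M ◁ (f.app p.c₁ ⊗ₘ f.app p.c₂)

/-- One side of the field theory condition for a pair of orthogonal morphisms, given by an
operation `r` of arity two. -/
def Orthogonality.Pair.binary {oC : Orthogonality C} (p : oC.Pair) {P : Operad M}
    (r : 𝟙_ M ⟶ P.ob 2) :
    diagramForget C P ⋙ p.inputs ⟶ diagramForget C P ⋙ (evaluation C M).obj p.c where
  app 𝔄 := (r ⊗ₘ (((𝔄.map p.f₁).hom ⊗ₘ (𝔄.map p.f₂).hom) ≫ tensTwo (𝔄.obj p.c).carrier)) ≫
    (𝔄.obj p.c).act 2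
  naturality _ _ τ :=
    binary_natural (τ.app p.c).act_hom r (congrArg Alg.Hom.hom (τ.naturality p.f₁)).symm
      (congrArg Alg.Hom.hom (τ.naturality p.f₂)).symm

variable [MonoidalClosed M] [HasColimits M]

instance preservesEpimorphisms_inputs {oC : Orthogonality C} (p : oC.Pair) :
    (p.inputs (M := M)).PreservesEpimorphisms where
  preserves f _ :=
    have := epi_tensorHom (f.app p.c₁) (f.app p.c₂)
    epi_whiskerLeft _ _

/-- The field theory condition for a pair of orthogonal morphisms. -/
def fieldTheoryEquation {oC : Orthogonality C} (P : BipointedOperad M) (p : oC.Pair) :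
    Equation (diagramForget C P.toOperad) M where
  arity := p.inputs
  value := (evaluation C M).obj p.c
  lhs := p.binary P.r₁
  rhs := p.binary P.r₂
  preservesEpimorphisms_arity := inferInstance
  isRightAdjoint_value := inferInstance

lemma isFieldTheory_eq_models (oC : Orthogonality C) (P : BipointedOperad M) :
    isFieldTheory oC P = models (fieldTheoryEquation (oC := oC) P) := by
  ext 𝔄
  exact ⟨fun h p => h p.f₁ p.f₂ p.rel, fun h _ _ _ f₁ f₂ rel => h ⟨f₁, f₂, rel⟩⟩

instance isClosedUnderColimitsOfShape_isFieldTheory (oC : Orthogonality C)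
    (P : BipointedOperad M) :
    (isFieldTheory oC P).IsClosedUnderColimitsOfShape WalkingReflexivePair :=
  isFieldTheory_eq_models oC P ▸ inferInstance

/-- The functor which sends a field theory to its underlying diagram of objects. -/
abbrev FT.forget (oC : Orthogonality C) (P : BipointedOperad M) : FT oC P ⥤ C ⥤ M :=
  (isFieldTheory oC P).ι ⋙ diagramForget C P.toOperad

/-- The free algebras on the objects of a diagram form the free diagram of algebras. -/
noncomputable def diagramAdj (C : Type v) [SmallCategory C] (P : Operad M) :
    (Functor.whiskeringRight C _ _).obj (Alg.forget P).leftAdjoint ⊣ diagramForget C P :=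
  (Adjunction.ofIsRightAdjoint (Alg.forget P)).whiskerRight C

instance isRightAdjoint_FT_forget (oC : Orthogonality C) (P : BipointedOperad M) :
    (FT.forget oC P).IsRightAdjoint := by
  have := isRightAdjoint_models_ι_comp (fieldTheoryEquation (oC := oC) P)
    (diagramAdj C P.toOperad)
  rwa [← isFieldTheory_eq_models] at this

noncomputable instance monadicRightAdjoint_FT_forget (oC : Orthogonality C)
    (P : BipointedOperad M) : MonadicRightAdjoint (FT.forget oC P) :=
  Monad.monadicOfHasPreservesReflexiveCoequalizersOfReflectsIsomorphisms
    (Adjunction.ofIsRightAdjoint (FT.forget oC P))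

instance isRightAdjoint_changeOperad (oC : Orthogonality C) {P Q : BipointedOperad M}
    (φ : BipointedOperad.Hom P Q) : (changeOperad oC φ).IsRightAdjoint :=
  have : (changeOperad oC φ ⋙ FT.forget oC P).IsRightAdjoint :=
    inferInstanceAs (FT.forget oC Q).IsRightAdjoint
  isRightAdjoint_triangle_lift_monadic (FT.forget oC P)

instance isRightAdjoint_restrict {D : Type v} [SmallCategory D] {oC : Orthogonality C}
    {oD : Orthogonality D} {j : C ⥤ D} (hj : IsFullOrthogonalSubcategory oC oD j)
    (P : BipointedOperad M) : (restrict hj P).IsRightAdjoint :=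
  have : (restrict hj P ⋙ FT.forget oC P).IsRightAdjoint :=
    have : ((Functor.whiskeringLeft C D M).obj j).IsRightAdjoint :=
      (j.lanAdjunction M).isRightAdjoint
    inferInstanceAs (FT.forget oD P ⋙ (Functor.whiskeringLeft C D M).obj j).IsRightAdjoint
  isRightAdjoint_triangle_lift_monadic (FT.forget oC P)

end FieldTheories

section EpiUnits

variable {T N : Type*} [Category.{v} T] [Category.{v} N] {U : T ⥤ N} {F : N ⥤ T}

lemma isIso_counit_app_of_epi_unit_app (adj : F ⊣ U) (X : N) [Epi (adj.unit.app X)] :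
    IsIso (adj.counit.app (F.obj X)) := by
  have : F.PreservesEpimorphisms := Functor.preservesEpimorphisms_of_adjunction adj
  have triangle := adj.left_triangle_components X
  have : IsSplitMono (F.map (adj.unit.app X)) := ⟨⟨⟨_, triangle⟩⟩⟩
  have : IsIso (F.map (adj.unit.app X)) := isIso_of_epi_of_isSplitMono _
  exact IsIso.of_isIso_fac_left (h := 𝟙 _) triangle

instance isReflexivePair_counit (adj : F ⊣ U) (X : T) :
    IsReflexivePair (F.map (U.map (adj.counit.app X))) (adj.counit.app (F.obj (U.obj X))) :=
  .mk' (F.map (adj.unit.app (U.obj X)))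
    (by rw [← F.map_comp, adj.right_triangle_components]; exact F.map_id _)
    (adj.left_triangle_components _)

variable [HasColimitsOfShape WalkingReflexivePair T]

/-- The counit factors through the coequalizer of the reflexive pair `F U F U X ⇉ F U X` by an
isomorphism, because it has a section after applying `U`. -/
lemma epi_map_counit_app (adj : F ⊣ U) [PreservesColimitsOfShape WalkingReflexivePair U]
    [U.ReflectsIsomorphisms] {T' : Type*} [Category.{v} T'] (S : T ⥤ T')
    [PreservesColimitsOfShape WalkingReflexivePair S] (X : T) :
    Epi (S.map (adj.counit.app X)) := by
  let f : F.obj (U.obj (F.obj (U.obj X))) ⟶ F.obj (U.obj X) := F.map (U.map (adj.counit.app X))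
  let g : F.obj (U.obj (F.obj (U.obj X))) ⟶ F.obj (U.obj X) := adj.counit.app (F.obj (U.obj X))
  have : IsReflexivePair f g := isReflexivePair_counit adj X
  let d : coequalizer f g ⟶ X :=
    coequalizer.desc (adj.counit.app X) (adj.counit.naturality (adj.counit.app X))
  have π_d : coequalizer.π f g ≫ d = adj.counit.app X := coequalizer.π_desc _ _
  let s : U.obj X ⟶ U.obj (coequalizer f g) :=
    adj.unit.app (U.obj X) ≫ U.map (coequalizer.π f g)
  have s_map_d : s ≫ U.map d = 𝟙 _ := by
    rw [Category.assoc, ← U.map_comp, π_d, adj.right_triangle_components]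
  have π_map_d_s : U.map (coequalizer.π f g) ≫ U.map d ≫ s = U.map (coequalizer.π f g) := by
    have unit_natural : U.map (adj.counit.app X) ≫ adj.unit.app (U.obj X) =
        adj.unit.app _ ≫ U.map f := adj.unit.naturality _
    rw [← Category.assoc, ← U.map_comp, π_d, ← Category.assoc, unit_natural, Category.assoc,
      ← U.map_comp, coequalizer.condition, U.map_comp, ← Category.assoc]
    exact (congrArg (· ≫ _) (adj.right_triangle_components _)).trans (Category.id_comp _)
  have := epi_map_coequalizer_π U f g
  have : IsIso (U.map d) := ⟨s, by rw [← cancel_epi (U.map (coequalizer.π f g)), π_map_d_s,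
    Category.comp_id], s_map_d⟩
  have := isIso_of_reflects_iso d U
  have := epi_map_coequalizer_π S f g
  rw [← π_d, S.map_comp]
  exact epi_comp _ _

lemma epi_unit_app_of_epi_unit_app_free (adj : F ⊣ U)
    [PreservesColimitsOfShape WalkingReflexivePair U] [U.ReflectsIsomorphisms]
    {T' : Type*} [Category.{v} T'] {R : T' ⥤ T} {L : T ⥤ T'}
    [PreservesColimitsOfShape WalkingReflexivePair R] (adj' : L ⊣ R)
    (h : ∀ G, Epi (adj'.unit.app (F.obj G))) (X : T) : Epi (adj'.unit.app X) := by
  have := h (U.obj X)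
  have : PreservesColimitsOfShape WalkingReflexivePair L :=
    adj'.leftAdjoint_preservesColimits.preservesColimitsOfShape
  have := epi_map_counit_app adj (L ⋙ R) X
  have unit_natural : adj.counit.app X ≫ adj'.unit.app X =
      adj'.unit.app (F.obj (U.obj X)) ≫ (L ⋙ R).map (adj.counit.app X) :=
    adj'.unit.naturality _
  have : Epi (adj.counit.app X ≫ adj'.unit.app X) := unit_natural ▸ epi_comp _ _
  exact epi_of_epi (adj.counit.app X) _

end EpiUnits

section UniversalMorphisms

variable {T T' N : Type*} [Category.{v} T] [Category.{v} T'] [Category.{v} N]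
  {U : T ⥤ N} {F : N ⥤ T} (adj : F ⊣ U) {R : T' ⥤ T} {F' : N ⥤ T'} (adj' : F' ⊣ R ⋙ U)

lemma homEquiv_symm_unit_comp_map {G : N} {B : T'} (h : F'.obj G ⟶ B) :
    (adj.homEquiv G (R.obj (F'.obj G))).symm (adj'.unit.app G) ≫ R.map h =
      (adj.homEquiv G (R.obj B)).symm (adj'.homEquiv G B h) := by
  rw [← Adjunction.homEquiv_naturality_right_symm, Adjunction.homEquiv_unit]
  rfl

lemma homEquiv_symm_unit_comp_leftAdjointUniq {F'' : N ⥤ T'} (adj'' : F'' ⊣ R ⋙ U) (G : N) :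
    (adj.homEquiv G (R.obj (F'.obj G))).symm (adj'.unit.app G) ≫
        R.map ((Adjunction.leftAdjointUniq adj' adj'').hom.app G) =
      (adj.homEquiv G (R.obj (F''.obj G))).symm (adj''.unit.app G) := by
  rw [homEquiv_symm_unit_comp_map, Adjunction.homEquiv_leftAdjointUniq_hom_app]

lemma epi_homEquiv_symm [R.Faithful] {G : N} {B : T'} {g : G ⟶ U.obj (R.obj B)}
    (hg : Epi ((adj.homEquiv G (R.obj B)).symm g)) : Epi ((adj'.homEquiv G B).symm g) := by
  have : Epi (R.map ((adj'.homEquiv G B).symm g)) := by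
    refine epi_of_epi_fac (f := (adj.homEquiv G (R.obj (F'.obj G))).symm (adj'.unit.app G))
      (h := (adj.homEquiv G (R.obj B)).symm g) ?_
    rw [homEquiv_symm_unit_comp_map, Equiv.apply_symm_apply]
  exact R.epi_of_epi_map this

end UniversalMorphisms

section LocalFieldTheories

variable {M : Type u} [Category.{v} M] [MonoidalCategory M] [SymmetricCategory M]
  [MonoidalClosed M] [HasColimits M] {C D : Type v} [SmallCategory C] [SmallCategory D]
  {oC : Orthogonality C} {oD : Orthogonality D} {j : C ⥤ D}

lemma epi_diagramForget_map_homEquiv_symm_unit {P : BipointedOperad M}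
    {F : (D ⥤ M) ⥤ FT oD P} (adj : F ⊣ FT.forget oD P) (G : D ⥤ M) :
    Epi ((diagramForget D P.toOperad).map
      (((diagramAdj D P.toOperad).homEquiv G (F.obj G).obj).symm (adj.unit.app G))) := by
  suffices h : ∀ {S : ObjectProperty (D ⥤ Alg P.toOperad)},
      S = models (fieldTheoryEquation (oC := oD) P) →
      ∀ {F : (D ⥤ M) ⥤ S.FullSubcategory} (adj : F ⊣ S.ι ⋙ diagramForget D P.toOperad),
        Epi ((diagramForget D P.toOperad).map
          (((diagramAdj D P.toOperad).homEquiv G (F.obj G).obj).symm (adj.unit.app G))) from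
    h (isFieldTheory_eq_models oD P) adj
  rintro _ rfl F adj
  exact epi_map_homEquiv_symm_unit _ adj G

instance preservesColimitsOfShape_restrict (hj : IsFullOrthogonalSubcategory oC oD j)
    (P : BipointedOperad M) :
    PreservesColimitsOfShape WalkingReflexivePair (restrict hj P) :=
  have : PreservesColimitsOfShape WalkingReflexivePair (restrict hj P ⋙ FT.forget oC P) :=
    inferInstanceAs (PreservesColimitsOfShape WalkingReflexivePair
      (FT.forget oD P ⋙ (Functor.whiskeringLeft C D M).obj j))
  have : ReflectsColimitsOfShape WalkingReflexivePair (FT.forget oC P) :=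
    reflectsColimitsOfShape_of_reflectsIsomorphisms
  preservesColimitsOfShape_of_reflects_of_preserves (restrict hj P) (FT.forget oC P)


lemma homEquiv_diagramAdj_symm_whiskerLeft (j : C ⥤ D) {P : Operad M} {H : D ⥤ M}
    {𝔄 : D ⥤ Alg P} (u : H ⟶ (diagramForget D P).obj 𝔄) :
    ((diagramAdj C P).homEquiv (j ⋙ H) (j ⋙ 𝔄)).symm (Functor.whiskerLeft j u) =
      Functor.whiskerLeft j (((diagramAdj D P).homEquiv H 𝔄).symm u) := by
  rw [Adjunction.homEquiv_counit, Adjunction.homEquiv_counit]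
  rfl

lemma epi_homEquiv_diagramAdj_symm (j : C ⥤ D) {P : Operad M} {G : C ⥤ M} {H : D ⥤ M}
    {𝔄 : D ⥤ Alg P} (η : G ⟶ j ⋙ H) [IsIso η] (u : H ⟶ (diagramForget D P).obj 𝔄)
    (hu : Epi ((diagramForget D P).map (((diagramAdj D P).homEquiv H 𝔄).symm u))) :
    Epi (((diagramAdj C P).homEquiv G (j ⋙ 𝔄)).symm (η ≫ Functor.whiskerLeft j u)) := by
  have homEquiv_symm_comp : ((diagramAdj C P).homEquiv G (j ⋙ 𝔄)).symm
      (η ≫ Functor.whiskerLeft j u) =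
        ((Functor.whiskeringRight C _ _).obj (Alg.forget P).leftAdjoint).map η ≫
          Functor.whiskerLeft j (((diagramAdj D P).homEquiv H 𝔄).symm u) := by
    rw [← homEquiv_diagramAdj_symm_whiskerLeft]
    exact Adjunction.homEquiv_naturality_left_symm _ _ _
  have := epi_whiskerLeft_of_epi_diagramForget_map j (((diagramAdj D P).homEquiv H 𝔄).symm u)
  rw [homEquiv_symm_comp]
  exact epi_comp _ _

lemma epi_homEquiv_symm_lan_unit (hj : IsFullOrthogonalSubcategory oC oD j)
    {P : BipointedOperad M} {FC : (C ⥤ M) ⥤ FT oC P} (adjC : FC ⊣ FT.forget oC P)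
    {FD : (D ⥤ M) ⥤ FT oD P} (adjD : FD ⊣ FT.forget oD P) (G : C ⥤ M) :
    Epi ((adjC.homEquiv G ((restrict hj P).obj (FD.obj (j.lan.obj G)))).symm
      (((j.lanAdjunction M).comp adjD).unit.app G)) := by
  have := hj.full
  have := hj.faithful
  let η : G ⟶ j ⋙ j.lan.obj G := (j.lanAdjunction M).unit.app G
  have : IsIso η := inferInstanceAs (IsIso ((j.lanAdjunction M).unit.app G))
  let u : j.lan.obj G ⟶ (FT.forget oD P).obj (FD.obj (j.lan.obj G)) := adjD.unit.app (j.lan.obj G)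
  have unit_eq : ((j.lanAdjunction M).comp adjD).unit.app G = η ≫ Functor.whiskerLeft j u :=
    Adjunction.comp_unit_app _ _ G
  rw [unit_eq]
  exact epi_homEquiv_symm (diagramAdj C P.toOperad) adjC (B := (restrict hj P).obj _)
    (epi_homEquiv_diagramAdj_symm j η u (epi_diagramForget_map_homEquiv_symm_unit adjD _))

lemma epi_unit_app_free (hj : IsFullOrthogonalSubcategory oC oD j)
    {P : BipointedOperad M} {FC : (C ⥤ M) ⥤ FT oC P} (adjC : FC ⊣ FT.forget oC P)
    {L : FT oC P ⥤ FT oD P} (adj : L ⊣ restrict hj P) (G : C ⥤ M) :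
    Epi (adj.unit.app (FC.obj G)) := by
  let adjD := Adjunction.ofIsRightAdjoint (FT.forget oD P)
  let adjLan : j.lan ⋙ (FT.forget oD P).leftAdjoint ⊣ restrict hj P ⋙ FT.forget oC P :=
    (j.lanAdjunction M).comp adjD
  have : Epi ((adjC.homEquiv G ((restrict hj P).obj
      ((j.lan ⋙ (FT.forget oD P).leftAdjoint).obj G))).symm (adjLan.unit.app G)) :=
    epi_homEquiv_symm_lan_unit hj adjC adjD G
  have unit_eq : (adjC.homEquiv G ((L ⋙ restrict hj P).obj (FC.obj G))).symm
      ((adjC.comp adj).unit.app G) = adj.unit.app (FC.obj G) := by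
    rw [Equiv.symm_apply_eq, Adjunction.comp_unit_app, Adjunction.homEquiv_unit]
  rw [← unit_eq]
  exact homEquiv_symm_unit_comp_leftAdjointUniq adjC adjLan (adjC.comp adj) G ▸ epi_comp _ _

lemma epi_unit_app_restrict (hj : IsFullOrthogonalSubcategory oC oD j) {P : BipointedOperad M}
    {L : FT oC P ⥤ FT oD P} (adj : L ⊣ restrict hj P) (𝔄 : FT oC P) : Epi (adj.unit.app 𝔄) :=
  let adjC := Adjunction.ofIsRightAdjoint (FT.forget oC P)
  epi_unit_app_of_epi_unit_app_free adjC adj (epi_unit_app_free hj adjC adj) 𝔄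

lemma isLocal_leftAdjoint_obj (hj : IsFullOrthogonalSubcategory oC oD j)
    {P Q : BipointedOperad M} {φ : BipointedOperad.Hom P Q} {L : FT oD P ⥤ FT oD Q}
    (adj : L ⊣ changeOperad oD φ) {𝔄 : FT oD P} (h𝔄 : IsLocal hj 𝔄) : IsLocal hj (L.obj 𝔄) := by
  obtain ⟨L₀, adj₀, _⟩ := h𝔄
  let adjC := Adjunction.ofIsRightAdjoint (changeOperad oC φ)
  let adjQ := Adjunction.ofIsRightAdjoint (restrict hj Q)
  let e := Adjunction.leftAdjointUniq (adj₀.comp adj)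
    (Adjunction.ofNatIsoRight (adjC.comp adjQ) (Iso.refl (changeOperad oD φ ⋙ restrict hj P)))
  let i : L.obj 𝔄 ≅ (restrict hj Q).leftAdjoint.obj
      ((changeOperad oC φ).leftAdjoint.obj ((restrict hj P).obj 𝔄)) :=
    (L.mapIso (asIso (adj₀.counit.app 𝔄))).symm ≪≫ e.app ((restrict hj P).obj 𝔄)
  have := epi_unit_app_restrict hj adjQ
    ((changeOperad oC φ).leftAdjoint.obj ((restrict hj P).obj 𝔄))
  exact ⟨_, adjQ, (NatTrans.isIso_app_iff_of_iso adjQ.counit i).2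
    (isIso_counit_app_of_epi_unit_app adjQ _)⟩

end LocalFieldTheories

end OperadicFT

theorem proposition4p8_general {M : Type u} [Category.{v} M] [MonoidalCategory M]
    [SymmetricCategory M] [MonoidalClosed M] [HasColimits M]
    {C D : Type v} [SmallCategory C] [SmallCategory D]
    (oC : OperadicFT.Orthogonality C) (oD : OperadicFT.Orthogonality D) (j : C ⥤ D)
    (hj : OperadicFT.IsFullOrthogonalSubcategory oC oD j)
    (P Q : OperadicFT.BipointedOperad M) (φ : OperadicFT.BipointedOperad.Hom P Q)
    (W : MorphismProperty C) :
    ((OperadicFT.changeOperad oD φ).IsRightAdjoint ∧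
      (OperadicFT.changeOperad oC φ).IsRightAdjoint ∧
      (OperadicFT.restrict hj P).IsRightAdjoint ∧
      (OperadicFT.restrict hj Q).IsRightAdjoint) ∧
    (∀ (L : OperadicFT.FT oD P ⥤ OperadicFT.FT oD Q), (L ⊣ OperadicFT.changeOperad oD φ) →
      ∀ 𝔄 : OperadicFT.FT oD P, OperadicFT.IsLocal hj 𝔄 → OperadicFT.IsLocal hj (L.obj 𝔄)) ∧
    (∀ 𝔅 : OperadicFT.FT oC Q, OperadicFT.IsConstantOn W 𝔅 →
      OperadicFT.IsConstantOn W ((OperadicFT.changeOperad oC φ).obj 𝔅)) := by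
  refine ⟨⟨OperadicFT.isRightAdjoint_changeOperad oD φ,
    OperadicFT.isRightAdjoint_changeOperad oC φ,
    OperadicFT.isRightAdjoint_restrict hj P, OperadicFT.isRightAdjoint_restrict hj Q⟩,
    fun L adj 𝔄 h𝔄 => OperadicFT.isLocal_leftAdjoint_obj hj adj h𝔄, fun 𝔅 h𝔅 c c' f hf => ?_⟩
  have := h𝔅 f hf
  exact inferInstanceAs (IsIso ((OperadicFT.pullbackAlg φ.toHom).map (𝔅.obj.map f)))

theorem proposition4p8 {M : Type u} [Category.{v} M] [MonoidalCategory M] [SymmetricCategory M]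
    [MonoidalClosed M] [HasLimits M] [HasColimits M]
    {C D : Type v} [SmallCategory C] [SmallCategory D]
    (oC : OperadicFT.Orthogonality C) (oD : OperadicFT.Orthogonality D) (j : C ⥤ D)
    (hj : OperadicFT.IsFullOrthogonalSubcategory oC oD j)
    (P Q : OperadicFT.BipointedOperad M) (φ : OperadicFT.BipointedOperad.Hom P Q)
    (W : MorphismProperty C) :
    -- the adjunctions `(φ^*)^! ⊣ (φ^*)_*` (on `D` and on `C`) and `j_! ⊣ j^*` exist
    ((OperadicFT.changeOperad oD φ).IsRightAdjoint ∧
      (OperadicFT.changeOperad oC φ).IsRightAdjoint ∧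
      (OperadicFT.restrict hj P).IsRightAdjoint ∧
      (OperadicFT.restrict hj Q).IsRightAdjoint) ∧
    -- the left adjoint `(φ^*)^!` preserves `j`-local field theories
    (∀ (L : OperadicFT.FT oD P ⥤ OperadicFT.FT oD Q), (L ⊣ OperadicFT.changeOperad oD φ) →
      ∀ 𝔄 : OperadicFT.FT oD P, OperadicFT.IsLocal hj 𝔄 → OperadicFT.IsLocal hj (L.obj 𝔄)) ∧
    -- the right adjoint `(φ^*)_*` preserves `W`-constant field theories
    (∀ 𝔅 : OperadicFT.FT oC Q, OperadicFT.IsConstantOn W 𝔅 →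
      OperadicFT.IsConstantOn W ((OperadicFT.changeOperad oC φ).obj 𝔅)) :=
  proposition4p8_general oC oD j hj P Q φ W
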